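/- Let $d,n\ge 1$, let $A$ be a real $d\times d$ matrix all of whose (complex) eigenvalues have modulus $>1$, and let $\mathcal D_{ij}\subset\mathbb R^d$ ($1\le i,j\le n$) be finite sets. A multiset $X$ in $\mathbb R^d$ is given by a multiplicity function $m_X:\mathbb R^d\to\mathbb Z_{\ge0}$; $\bigvee$ denotes multiset union (multiplicities are added), and $X+\mathcal D=\bigvee_{\mathbf d\in\mathcal D}(X+\mathbf d)$. The inflation operator $\psi$ sends a family $\mathcal X=(X_1,\dots,X_n)$ of multisets to $\psi(\mathcal X)=(X_1',\dots,X_n')$ with $$X_i'=\bigvee_{j=1}^n\bigl(A(X_j)+\mathcal D_{ij}\bigr),$$ and its iterate $\psi^N$ ($N\ge1$) is the inflation operator of the data $(A^N,\mathcal D^N_{ij})$, where $\mathcal D^1_{ij}=\mathcal D_{ij}$ and $\mathcal D^{k+1}_{ij}=\bigvee_{l=1}^n(\mathcal D^{k}_{il}+A^{k}\mathcal D_{lj})$ are finite multisets. The associated multi-tile equation is $$A(T_i)=\bigcup_{j=1}^n (T_j+\mathcal D_{ji}),\qquad 1\le i\le n,$$ as an equation between sets (multiplicities ignored) for compact sets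 $T_1,\dots,T_n\subset\mathbb R^d$, not all empty; the multi-tile equation of $\psi^N$ is the same equation for the data $(A^N,\mathcal D^N_{ij})$. A multiset is weakly uniformly discrete if for some $r>0$ and $m\ge1$ every open ball of radius $r$ contains at most $m$ of its points, counted with multiplicity; uniformly discrete if one can take $m=1$; relatively dense if for some $R>0$ every closed ball of radius $R$ contains one of its points; a Delone set if it is uniformly discrete and relatively dense. A family $(X_1,\dots,X_n)$ is weakly uniformly discrete if $\bigvee_i X_i$ is weakly uniformly discrete, uniformly discrete if each $X_i$ is uniformly discrete, and nonempty if some $X_i$ is nonempty. A family $\mathcal X$ is a self-replicating multi-tiling family for $\psi^N$ if $\psi^N(\mathcal X)=\mathcal X$, each $X_i$ is a Delone set, the multi-tile equation of $\psi^N$ has a unique solution $(T_1,\dots,T_n)$ in compact sets that are not all empty, all these $T_i$ have positive Lebesgue measure, and the tiles $T_i+\mathbf x$ ($1\le i\le n$, $\mathbf x\in X_i$) tile $\mathbb R^d$: they cover $\mathbb R^d$, and almost every point lies in exactly one of them. Assume that the subdivision matrix $S=[\,|\mathcal D_{ij}|\,]_{1\le i,j\le n}$ is primitive (some power $S^k$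 with $k\ge 1$ has only positive entries), and that its Perron eigenvalue (its spectral radius) satisfies $\lambda(S)=|\det A|$. Then the following conditions are equivalent: (i) for some $N>0$ there is a nonempty weakly uniformly discrete family $\hat{\mathcal X}$ with $\psi^N(\hat{\mathcal X})=\hat{\mathcal X}$; (ii) for some $N>0$ there is a nonempty uniformly discrete family $\hat{\mathcal X}$ with $\psi^N(\hat{\mathcal X})=\hat{\mathcal X}$; (iii) for some $N>0$ there is a self-replicating multi-tiling family $\hat{\mathcal X}$ for $\psi^N$, with $\psi^N(\hat{\mathcal X})=\hat{\mathcal X}$; (iv) the multi-tile equation has a unique solution $(T_1,\dots,T_n)$ in compact sets that are not all empty, and all these $T_i$ have positive Lebesgue measure. -/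

import Mathlib

open MeasureTheory
open scoped Pointwise

/-- The data `(A, D_ij)` of an inflation functional equation and of the associated multi-tile
equation: a `d × d` real matrix and an `n × n` array of finite digit collections in `ℝ^d`.
The digits are finite multisets, since the digits of the iterated equations may carry
multiplicities; an ordinary system is one that comes from finite digit sets
(`InflationSystem.ofDigitSets`). -/
structure InflationSystem (d n : ℕ) where
  mat : Matrix (Fin d) (Fin d) ℝ
  digits : Fin n → Fin n → Multiset (EuclideanSpace ℝ (Fin d))

/-- A multiset in `ℝ^d`, given by its multiplicity function (extended by zero). -/
abbrev PointMultiset (d : ℕ) : Type := EuclideanSpace ℝ (Fin d) → ℕ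

namespace PointMultiset

variable {d : ℕ}

/-- There are `r > 0` and `M` such that any open ball of radius `r` contains at most `M` points,
counted with multiplicity. (The total multiplicity in a ball is at most `M` if and only if this
holds for every finite set of points of the ball.) -/
def IsWeaklyUniformlyDiscrete (X : PointMultiset d) : Prop :=
  ∃ r : ℝ, 0 < r ∧ ∃ M : ℕ, 1 ≤ M ∧ ∀ (c : EuclideanSpace ℝ (Fin d))
    (s : Finset (EuclideanSpace ℝ (Fin d))), (s : Set (EuclideanSpace ℝ (Fin d))) ⊆ Metric.ball c r →
      ∑ x ∈ s, X x ≤ M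

/-- There is `r > 0` such that any open ball of radius `r` contains at most one point,
counted with multiplicity. -/
def IsUniformlyDiscrete (X : PointMultiset d) : Prop :=
  ∃ r : ℝ, 0 < r ∧ ∀ (c : EuclideanSpace ℝ (Fin d))
    (s : Finset (EuclideanSpace ℝ (Fin d))), (s : Set (EuclideanSpace ℝ (Fin d))) ⊆ Metric.ball c r →
      ∑ x ∈ s, X x ≤ 1

/-- There is `R > 0` such that every closed ball of radius `R` contains a point of `X`. -/
def IsRelativelyDense (X : PointMultiset d) : Prop :=
  ∃ R : ℝ, 0 < R ∧ ∀ c : EuclideanSpace ℝ (Fin d), ∃ x ∈ Metric.closedBall c R, X x ≠ 0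

/-- A Delone set: uniformly discrete (hence an ordinary set) and relatively dense. -/
def IsDelone (X : PointMultiset d) : Prop :=
  X.IsUniformlyDiscrete ∧ X.IsRelativelyDense

end PointMultiset

/-- An `n`-multiset family `(X_1, …, X_n)` in `ℝ^d`. -/
abbrev MultisetFamily (d n : ℕ) : Type := Fin n → PointMultiset d

namespace MultisetFamily

variable {d n : ℕ}

/-- The family is not the empty family, i.e. some `X_i` has a point. -/
def IsNonempty (X : MultisetFamily d n) : Prop :=
  ∃ i x, X i x ≠ 0

/-- The multiset union of the members is weakly uniformly discrete. -/
def IsWeaklyUniformlyDiscrete (X : MultisetFamily d n) : Prop :=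
  PointMultiset.IsWeaklyUniformlyDiscrete (fun x => ∑ i, X i x)

/-- Each member is uniformly discrete. -/
def IsUniformlyDiscrete (X : MultisetFamily d n) : Prop :=
  ∀ i, (X i).IsUniformlyDiscrete

end MultisetFamily

/-- The matrix `A` is expanding: all its (complex) eigenvalues have modulus `> 1`. -/
def Matrix.IsExpanding {d : ℕ} (A : Matrix (Fin d) (Fin d) ℝ) : Prop :=
  ∀ z ∈ spectrum ℂ (A.map (algebraMap ℝ ℂ)), 1 < ‖z‖

/-- The Perron eigenvalue `λ(S)` of a primitive nonnegative matrix, i.e. its spectral radius. -/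
noncomputable def Matrix.perronEigenvalue {n : ℕ} (S : Matrix (Fin n) (Fin n) ℝ) : ℝ :=
  (spectralRadius ℂ (S.map (algebraMap ℝ ℂ))).toReal

/-- The tiles `T_i + x`, for `1 ≤ i ≤ n` and `x ∈ X_i`, tile `ℝ^d`: they cover `ℝ^d`, and almost
every point (for Lebesgue measure) lies in exactly one of them. -/
def IsTilingBy {d n : ℕ} (T : Fin n → Set (EuclideanSpace ℝ (Fin d)))
    (X : MultisetFamily d n) : Prop :=
  (∀ y, ∃ p : Fin n × EuclideanSpace ℝ (Fin d), X p.1 p.2 ≠ 0 ∧ y ∈ p.2 +ᵥ T p.1) ∧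
  ∀ᵐ y ∂(volume : Measure (EuclideanSpace ℝ (Fin d))),
    ∃! p : Fin n × EuclideanSpace ℝ (Fin d), X p.1 p.2 ≠ 0 ∧ y ∈ p.2 +ᵥ T p.1

namespace InflationSystem

variable {d n : ℕ}

/-- The system with matrix `A` and finite digit sets `D_ij`. -/
def ofDigitSets (A : Matrix (Fin d) (Fin d) ℝ)
    (D : Fin n → Fin n → Finset (EuclideanSpace ℝ (Fin d))) : InflationSystem d n where
  mat := A
  digits i j := (D i j).val

/-- The subdivision matrix `S = [|D_ij|]`. -/
def subdivisionMatrix (P : InflationSystem d n) : Matrix (Fin n) (Fin n) ℝ :=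
  Matrix.of fun i j => ((P.digits i j).card : ℝ)

/-- The inflation operator `ψ(X)_i = ⋁_j (A X_j + D_ij)`, written through multiplicities:
`x` has multiplicity `∑_j ∑_{e ∈ D_ij} m_{X_j}(A⁻¹ (x - e))` in `ψ(X)_i`
(the matrix `A` is invertible as soon as it is expanding). -/
noncomputable def inflation (P : InflationSystem d n) (X : MultisetFamily d n) :
    MultisetFamily d n :=
  fun i x => ∑ j, ((P.digits i j).map
    fun e => X j (Matrix.toEuclideanLin P.mat⁻¹ (x - e))).sum

/-- The digit multisets of the `N`-th iterate:
`D^0_ij` is `{0}` for `i = j` and empty otherwise, and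
`D^{k+1}_ij = ⋁_l (D^k_il + A^k D_lj)`, with multiplicities. -/
noncomputable def iterDigits (P : InflationSystem d n) :
    ℕ → Fin n → Fin n → Multiset (EuclideanSpace ℝ (Fin d))
  | 0 => fun i j => if i = j then {0} else 0
  | k + 1 => fun i j => ∑ l, (iterDigits P k i l ×ˢ P.digits l j).map
      fun e => e.1 + Matrix.toEuclideanLin (P.mat ^ k) e.2

/-- The system `(A^N, D^N_ij)`, whose inflation operator is the `N`-th iterate `ψ^N`. -/
noncomputable def iterate (P : InflationSystem d n) (N : ℕ) : InflationSystem d n where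
  mat := P.mat ^ N
  digits := P.iterDigits N

/-- A nonempty compact solution of the multi-tile functional equation
`A T_i = ⋃_j (T_j + D_ji)`: all `T_i` are compact and not all of them are empty.
The unions do not count multiplicities. -/
def IsCompactMultiTileSolution (P : InflationSystem d n)
    (T : Fin n → Set (EuclideanSpace ℝ (Fin d))) : Prop :=
  (∀ i, IsCompact (T i)) ∧ (∃ i, (T i).Nonempty) ∧
  ∀ i, Matrix.toEuclideanLin P.mat '' T i = ⋃ j, (T j + {e | e ∈ P.digits j i})

/-- `T` is the unique nonempty compact solution of the multi-tile functional equation. -/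
def IsUniqueCompactMultiTileSolution (P : InflationSystem d n)
    (T : Fin n → Set (EuclideanSpace ℝ (Fin d))) : Prop :=
  P.IsCompactMultiTileSolution T ∧ ∀ T', P.IsCompactMultiTileSolution T' → T' = T

/-- `X` is a self-replicating multi-tiling family for the system `P`: it solves the inflation
functional equation of `P`, each `X_i` is a Delone set, the multi-tile equation of `P` has a
unique nonempty compact solution `T`, all `T_i` have positive Lebesgue measure, and the translates
`T_i + x`, `x ∈ X_i`, tile `ℝ^d`. -/
def IsSelfReplicatingMultiTilingFamily (P : InflationSystem d n) (X : MultisetFamily d n) : Prop :=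
  P.inflation X = X ∧ (∀ i, (X i).IsDelone) ∧
  ∃ T : Fin n → Set (EuclideanSpace ℝ (Fin d)),
    P.IsUniqueCompactMultiTileSolution T ∧ (∀ i, 0 < volume (T i)) ∧ IsTilingBy T X

end InflationSystem

/-!
The digits of the `m`-th iterate describe two things at once: the `m`-th subdivision
`Aᵐ T_i = ⋃_j (T_j + D^m_ji)` of a compact solution of the multi-tile equation, and the family grown
by `ψ^m` from one point. The equivalence comes from comparing volumes and cardinalities in these two
readings.

*Solutions.* Since `A` is expanding, `A⁻ᵐ → 0`. An adapted gauge gives a compact set preserved by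
the set map of the multi-tile equation, and the decreasing intersection of its images is a solution;
following the digits of a point through `m` subdivisions shows that the solution is unique, for the
system and for all its iterates (`IsCompactMultiTileSolution.isUnique`).

*From discreteness to positive measure.* If `ψ^N X = X` with `X` weakly uniformly discrete, every
`D^m_ij` (with `j` the type of a point of `X` and `N ∣ m`) sits inside a translate of `X_i`, so
balls of a fixed radius contain a bounded number of its elements. By primitivity and
`λ(S) = |det A|` it has at least `c |det A|^m` elements, hence the balls around its points fill a
volume of order `|det A|^m`. Pulled back by `A⁻ᵐ`, they lie in small neighbourhoods of the tile,
whose volume is therefore bounded below (`volume_pos_of_isWeaklyUniformlyDiscrete`).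

*From positive measure to interior points.* The volumes of the tiles satisfy
`|det A| vol T_i ≤ ∑_j S_ji vol T_j`. For a primitive matrix with Perron eigenvalue `|det A|` such
an inequality is an equality (`Matrix.IsPrimitive.vecMul_eq_of_le`), so the pieces of every
subdivision are disjoint in measure (`IsCompactMultiTileSolution.coverCount_le_one`). An averaging
argument (`exists_volume_vadd_diff_le`) finds unit balls that are filled by the pieces up to an
arbitrarily small measure. Only boundedly many pieces meet a unit ball, so a limit of these
arrangements exists, and finitely many tiles cover a ball; one of them has interior points.

*From interior points to a tiling.* A piece of type `i` of some subdivision of `T_i` lies in the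
interior of `T_i`. The contraction of `T_i` onto that piece has its fixed point in the interior.
Translating the tile so that this fixed point becomes the origin, the inflated patches are
increasing and exhaust the space, and their union is the required tiling
(`IsCompactMultiTileSolution.exists_isSelfReplicatingMultiTilingFamily`). Its translation sets are
uniformly discrete because the tiles contain balls and do not overlap, and relatively dense because
the tiles cover the space and all types occur in every large patch.
-/

open Filter Topology
open scoped ENNReal NNReal Matrix

/-! ### Powers of matrices and the spectral radius -/

/-- Gelfand's formula as a geometric bound on the powers. -/
theorem spectrum.exists_nnnorm_pow_le_of_spectralRadius_lt {R : Type*} [NormedRing R]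
    [NormedAlgebra ℂ R] [CompleteSpace R] {a : R} {r : ℝ≥0} (h : spectralRadius ℂ a < r) :
    ∃ q < r, ∀ᶠ m : ℕ in atTop, ‖a ^ m‖₊ ≤ q ^ m := by
  obtain ⟨q, hq1, hq2⟩ := ENNReal.lt_iff_exists_nnreal_btwn.1 h
  refine ⟨q, by exact_mod_cast hq2, ?_⟩
  have hlim := spectrum.pow_nnnorm_pow_one_div_tendsto_nhds_spectralRadius a
  filter_upwards [hlim.eventually_lt_const hq1, eventually_gt_atTop 0] with m hm hm0
  have h1 : ((‖a ^ m‖₊ : ℝ≥0∞) ^ (1 / m : ℝ)) ^ (m : ℝ) ≤ (q : ℝ≥0∞) ^ (m : ℝ) :=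
    ENNReal.rpow_le_rpow hm.le (by positivity)
  rw [← ENNReal.rpow_mul, one_div, inv_mul_cancel₀ (by positivity), ENNReal.rpow_one,
    ENNReal.rpow_natCast] at h1
  exact_mod_cast h1

namespace Matrix

section

attribute [local instance] Matrix.linftyOpNormedRing Matrix.linftyOpNormedAlgebra

variable {ι : Type*} [Fintype ι] [DecidableEq ι]

theorem norm_apply_le_linfty_opNorm (M : Matrix ι ι ℂ) (i j : ι) : ‖M i j‖ ≤ ‖M‖ := by
  rw [Matrix.linfty_opNorm_def]
  have h1 : ‖M i j‖₊ ≤ ∑ j, ‖M i j‖₊ :=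
    Finset.single_le_sum (f := fun j => ‖M i j‖₊) (fun _ _ => zero_le) (Finset.mem_univ j)
  have h2 : ∑ j, ‖M i j‖₊ ≤ Finset.univ.sup fun i => ∑ j, ‖M i j‖₊ :=
    Finset.le_sup (f := fun i => ∑ j, ‖M i j‖₊) (Finset.mem_univ i)
  exact_mod_cast h1.trans h2

theorem map_algebraMap_pow (S : Matrix ι ι ℝ) (m : ℕ) :
    (S.map (algebraMap ℝ ℂ)) ^ m = (S ^ m).map (algebraMap ℝ ℂ) :=
  (map_pow (algebraMap ℝ ℂ).mapMatrix S m).symm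

theorem abs_pow_apply_le (S : Matrix ι ι ℝ) (m : ℕ) (i j : ι) :
    |(S ^ m) i j| ≤ ‖(S.map (algebraMap ℝ ℂ)) ^ m‖ := by
  have := norm_apply_le_linfty_opNorm ((S.map (algebraMap ℝ ℂ)) ^ m) i j
  rw [map_algebraMap_pow] at this ⊢
  simpa using this

theorem exists_linfty_opNorm_le [Nonempty ι] (S : Matrix ι ι ℝ) (m : ℕ) :
    ∃ i j, ‖(S.map (algebraMap ℝ ℂ)) ^ m‖ ≤ Fintype.card ι * |(S ^ m) i j| := by
  obtain ⟨p, hp⟩ := Finite.exists_max (fun p : ι × ι => |(S ^ m) p.1 p.2|)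
  refine ⟨p.1, p.2, ?_⟩
  rw [map_algebraMap_pow, Matrix.linfty_opNorm_def]
  have : (Finset.univ.sup fun i => ∑ j, ‖((S ^ m).map (algebraMap ℝ ℂ)) i j‖₊) ≤
      (Fintype.card ι * ‖(S ^ m) p.1 p.2‖₊ : ℝ≥0) := by
    refine Finset.sup_le fun i _ => ?_
    refine (Finset.sum_le_card_nsmul _ _ ‖(S ^ m) p.1 p.2‖₊ fun j _ => ?_).trans ?_
    · rw [← NNReal.coe_le_coe]
      simpa using hp (i, j)
    · simp
  have h2 := NNReal.coe_le_coe.2 this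
  simpa using h2

/-- The entries of the powers of the inverse of an expanding matrix tend to zero. -/
theorem IsExpanding.tendsto_inv_pow {d : ℕ} (hd : 0 < d) {A : Matrix (Fin d) (Fin d) ℝ}
    (hA : A.IsExpanding) :
    IsUnit A.det ∧ ∀ i j, Tendsto (fun m : ℕ => (A⁻¹ ^ m) i j) atTop (𝓝 0) := by
  have : Nonempty (Fin d) := ⟨⟨0, hd⟩⟩
  have hunit : IsUnit (A.map (algebraMap ℝ ℂ)) := by
    by_contra h
    have := hA 0 ((spectrum.zero_mem_iff ℂ).2 h)
    simp at this
    linarith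
  have hdet : IsUnit A.det := by
    rw [Matrix.isUnit_iff_isUnit_det] at hunit
    have h1 : (A.map (algebraMap ℝ ℂ)).det = algebraMap ℝ ℂ A.det :=
      ((algebraMap ℝ ℂ).map_det A).symm
    rw [h1] at hunit
    exact isUnit_iff_ne_zero.2 fun h => by simp [h] at hunit
  refine ⟨hdet, ?_⟩
  obtain ⟨u, hu⟩ := hunit
  have hinv : (A⁻¹).map (algebraMap ℝ ℂ) = ((u⁻¹ : (Matrix (Fin d) (Fin d) ℂ)ˣ) :
      Matrix (Fin d) (Fin d) ℂ) := by
    refine Units.eq_inv_of_mul_eq_one_left ?_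
    rw [hu]
    change (algebraMap ℝ ℂ).mapMatrix A * (algebraMap ℝ ℂ).mapMatrix A⁻¹ = 1
    rw [← map_mul, Matrix.mul_nonsing_inv _ hdet, map_one]
  have hrad : spectralRadius ℂ ((A⁻¹).map (algebraMap ℝ ℂ)) < (1 : ℝ≥0) := by
    refine spectrum.spectralRadius_lt_of_forall_lt _ fun z hz => ?_
    rw [hinv, ← spectrum.map_inv, Set.mem_inv, hu] at hz
    have := hA _ hz
    rw [norm_inv] at this
    have h0 : 0 < ‖z‖ := by
      by_contra h
      have : ‖z‖ = 0 := le_antisymm (not_lt.1 h) (norm_nonneg _)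
      simp [this] at *
      linarith
    rw [← NNReal.coe_lt_coe]
    simpa using (one_lt_inv₀ h0).1 this
  obtain ⟨q, hq, hqm⟩ := spectrum.exists_nnnorm_pow_le_of_spectralRadius_lt hrad
  have h0 : Tendsto (fun m : ℕ => (q : ℝ) ^ m) atTop (𝓝 0) :=
    tendsto_pow_atTop_nhds_zero_of_lt_one q.2 (by exact_mod_cast hq)
  intro i j
  refine squeeze_zero_norm' ?_ h0
  filter_upwards [hqm] with m hm
  refine (abs_pow_apply_le _ m i j).trans ?_
  exact_mod_cast hm

theorem ofReal_perronEigenvalue {n : ℕ} (hn : 0 < n) (S : Matrix (Fin n) (Fin n) ℝ) :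
    ENNReal.ofReal S.perronEigenvalue = spectralRadius ℂ (S.map (algebraMap ℝ ℂ)) := by
  have : Nonempty (Fin n) := ⟨⟨0, hn⟩⟩
  have h : spectralRadius ℂ (S.map (algebraMap ℝ ℂ)) ≤ _ := spectrum.spectralRadius_le_nnnorm _
  exact ENNReal.ofReal_toReal (h.trans_lt ENNReal.coe_lt_top).ne

theorem perronEigenvalue_nonneg {n : ℕ} (S : Matrix (Fin n) (Fin n) ℝ) :
    0 ≤ S.perronEigenvalue := ENNReal.toReal_nonneg

theorem perronEigenvalue_pow_le_norm {n : ℕ} (hn : 0 < n) (S : Matrix (Fin n) (Fin n) ℝ)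
    {m : ℕ} (hm : m ≠ 0) :
    S.perronEigenvalue ^ m ≤ ‖(S.map (algebraMap ℝ ℂ)) ^ m‖ := by
  have : Nonempty (Fin n) := ⟨⟨0, hn⟩⟩
  have h := (spectrum.spectralRadius_pow_le (𝕜 := ℂ) (S.map (algebraMap ℝ ℂ)) m hm).trans
    (spectrum.spectralRadius_le_nnnorm _)
  rw [← ofReal_perronEigenvalue hn, ← ENNReal.ofReal_pow (perronEigenvalue_nonneg S),
    ← ENNReal.ofReal_coe_nnreal, ENNReal.ofReal_le_ofReal_iff (by positivity)] at h
  simpa using h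

/-- A positive vector that grows by a factor at least `ρ` bounds the spectral radius from below. -/
theorem le_perronEigenvalue_of_le_vecMul {n : ℕ} (hn : 0 < n) {S : Matrix (Fin n) (Fin n) ℝ}
    (hS : ∀ i j, 0 ≤ S i j) {w : Fin n → ℝ} (hw : ∀ i, 0 < w i) {ρ : ℝ}
    (h : ∀ i, ρ * w i ≤ (w ᵥ* S) i) : ρ ≤ S.perronEigenvalue := by
  by_contra! hlt
  have hρ : 0 < ρ := (perronEigenvalue_nonneg S).trans_lt hlt
  have hpow : ∀ m : ℕ, ∀ i, ρ ^ m * w i ≤ (w ᵥ* S ^ m) i := by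
    intro m
    induction m with
    | zero => simp
    | succ m ih =>
      intro i
      rw [pow_succ S, ← Matrix.vecMul_vecMul]
      calc ρ ^ (m + 1) * w i = ρ ^ m * (ρ * w i) := by ring
        _ ≤ ρ ^ m * (w ᵥ* S) i := by gcongr; exact h i
        _ = ∑ j, (ρ ^ m * w j) * S j i := by
          simp [Matrix.vecMul, dotProduct, Finset.mul_sum, mul_assoc]
        _ ≤ ∑ j, (w ᵥ* S ^ m) j * S j i :=
          Finset.sum_le_sum fun j _ => mul_le_mul_of_nonneg_right (ih j) (hS j i)
        _ = _ := rfl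
  have hrad : spectralRadius ℂ (S.map (algebraMap ℝ ℂ)) < (ρ.toNNReal : ℝ≥0) := by
    rw [← ofReal_perronEigenvalue hn]
    exact (ENNReal.ofReal_lt_ofReal_iff hρ).2 hlt
  obtain ⟨q, hq, hqm⟩ := spectrum.exists_nnnorm_pow_le_of_spectralRadius_lt hrad
  have hq' : (q : ℝ) < ρ := by
    have := NNReal.coe_lt_coe.2 hq
    rwa [Real.coe_toNNReal _ hρ.le] at this
  let i₀ : Fin n := ⟨0, hn⟩
  have hlim : Tendsto (fun m : ℕ => (∑ j, w j) * ((q : ℝ) / ρ) ^ m) atTop (𝓝 0) := by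
    simpa using (tendsto_pow_atTop_nhds_zero_of_lt_one (by positivity)
      ((div_lt_one hρ).2 hq')).const_mul (∑ j, w j)
  obtain ⟨m, hm1, hm2⟩ := ((hlim.eventually_lt_const (hw i₀)).and hqm).exists
  have h1 : (w ᵥ* S ^ m) i₀ ≤ (∑ j, w j) * (q : ℝ) ^ m := by
    rw [Finset.sum_mul]
    change ∑ j, w j * (S ^ m) j i₀ ≤ _
    refine Finset.sum_le_sum fun j _ => mul_le_mul_of_nonneg_left ?_ (hw j).le
    refine (le_abs_self _).trans ((abs_pow_apply_le S m j i₀).trans ?_)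
    exact_mod_cast hm2
  have h2 := (hpow m i₀).trans h1
  rw [div_pow, ← mul_div_assoc, div_lt_iff₀ (by positivity)] at hm1
  linarith

/-- For a primitive matrix, a positive subinvariant vector for the Perron eigenvalue is an
eigenvector. A strict inequality in one coordinate would spread to all of them after a power of the
matrix is applied, and the growth rate would exceed the spectral radius. -/
theorem IsPrimitive.vecMul_eq_of_le {n : ℕ} (hn : 0 < n) {S : Matrix (Fin n) (Fin n) ℝ}
    (hS : S.IsPrimitive) {v : Fin n → ℝ} (hv : ∀ i, 0 < v i)
    (h : ∀ i, S.perronEigenvalue * v i ≤ (v ᵥ* S) i) (i : Fin n) :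
    (v ᵥ* S) i = S.perronEigenvalue * v i := by
  by_contra hne
  have : Nonempty (Fin n) := ⟨i⟩
  obtain ⟨k, -, hk⟩ := hS.exists_pos_pow
  set lam := S.perronEigenvalue
  have hlt : lam * v i < (v ᵥ* S) i := lt_of_le_of_ne (h i) (Ne.symm hne)
  let w := v ᵥ* S ^ k
  let u := v ᵥ* S - lam • v
  have hu : ∀ j, 0 ≤ u j := fun j => by simpa [u] using h j
  have hui : 0 < u i := by simpa [u] using hlt
  have hw : ∀ j, 0 < w j := fun j =>
    Finset.sum_pos (fun l _ => mul_pos (hv l) (hk l j)) Finset.univ_nonempty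
  have hwu : w ᵥ* S - lam • w = u ᵥ* S ^ k := by
    simp only [w, u, Matrix.sub_vecMul, Matrix.vecMul_vecMul, Matrix.smul_vecMul,
      ← pow_succ, ← pow_succ']
  have hpos : ∀ j, 0 < (u ᵥ* S ^ k) j := fun j =>
    Finset.sum_pos' (fun l _ => mul_nonneg (hu l) (hk l j).le)
      ⟨i, Finset.mem_univ i, mul_pos hui (hk i j)⟩
  obtain ⟨j₀, hj₀⟩ := Finite.exists_min (fun j => (u ᵥ* S ^ k) j / w j)
  have hε : 0 < (u ᵥ* S ^ k) j₀ / w j₀ := div_pos (hpos _) (hw _)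
  have := le_perronEigenvalue_of_le_vecMul hn hS.nonneg hw
    (ρ := lam + (u ᵥ* S ^ k) j₀ / w j₀) fun j => by
      have h1 := hj₀ j
      rw [le_div_iff₀ (hw j), ← hwu] at h1
      rw [add_mul]
      simp only [Pi.sub_apply, Pi.smul_apply, smul_eq_mul] at h1
      rw [← hwu]
      simp only [Pi.sub_apply, Pi.smul_apply, smul_eq_mul]
      linarith
  linarith

/-- All entries of the powers of a primitive matrix grow at least like the powers of its Perron
eigenvalue. The norm of `S ^ r` is at least `λ ^ r`, so some entry is large, and the factors `S ^ k`
on both sides, whose entries are at least `σ > 0`, pass this on to every entry. -/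
theorem IsPrimitive.exists_mul_pow_le {n : ℕ} (hn : 0 < n) {S : Matrix (Fin n) (Fin n) ℝ}
    (hS : S.IsPrimitive) (hlam : 0 < S.perronEigenvalue) :
    ∃ c : ℝ, 0 < c ∧ ∃ m₀ : ℕ, ∀ m ≥ m₀, ∀ i j, c * S.perronEigenvalue ^ m ≤ (S ^ m) i j := by
  have : Nonempty (Fin n) := ⟨⟨0, hn⟩⟩
  obtain ⟨k, -, hk⟩ := hS.exists_pos_pow
  set lam := S.perronEigenvalue with hl
  obtain ⟨p, hp⟩ := Finite.exists_min (fun p : Fin n × Fin n => (S ^ k) p.1 p.2)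
  set σ := (S ^ k) p.1 p.2 with hσ
  have hσ0 : 0 < σ := hk _ _
  refine ⟨σ ^ 2 / n / lam ^ (2 * k), by positivity, 2 * k + 1, fun m hm i j => ?_⟩
  obtain ⟨r, rfl⟩ : ∃ r, m = k + r + k := ⟨m - 2 * k, by omega⟩
  obtain ⟨a, b, hab⟩ := exists_linfty_opNorm_le S r
  have h1 := (perronEigenvalue_pow_le_norm hn S (m := r) (by omega)).trans hab
  have hnn : ∀ m i j, 0 ≤ (S ^ m) i j := fun m i j => pow_apply_nonneg hS.nonneg m i j
  rw [abs_of_nonneg (hnn r a b), Fintype.card_fin] at h1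
  have h2 : (S ^ k) i a * (S ^ r) a b * (S ^ k) b j ≤ (S ^ (k + r + k)) i j := by
    rw [pow_add, pow_add, Matrix.mul_apply]
    refine le_trans ?_ (Finset.single_le_sum (f := fun b => (S ^ k * S ^ r) i b * (S ^ k) b j)
      (fun b _ => mul_nonneg ?_ (hnn _ _ _)) (Finset.mem_univ b))
    · refine mul_le_mul_of_nonneg_right ?_ (hnn _ _ _)
      exact Finset.single_le_sum (f := fun a => (S ^ k) i a * (S ^ r) a b)
        (fun a _ => mul_nonneg (hnn _ _ _) (hnn _ _ _)) (Finset.mem_univ a)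
    · rw [← pow_add]
      exact hnn _ _ _
  refine le_trans ?_ h2
  have hn' : (0 : ℝ) < n := by exact_mod_cast hn
  have h3 : lam ^ r / n ≤ (S ^ r) a b := by rwa [div_le_iff₀' hn']
  calc σ ^ 2 / n / lam ^ (2 * k) * lam ^ (k + r + k) = σ * (lam ^ r / n) * σ := by
        field_simp; ring
    _ ≤ (S ^ k) i a * (S ^ r) a b * (S ^ k) b j := by
        gcongr
        · exact mul_nonneg (hnn _ _ _) (hnn _ _ _)
        · exact hnn _ _ _
        · exact hp (i, a)
        · exact hp (b, j)

end

end Matrix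

/-! ### Sums over multisets -/

namespace Multiset

theorem sum_map_finset_sum {α β ι : Type*} [AddCommMonoid β] (s : Finset ι) (M : ι → Multiset α)
    (f : α → β) : ((∑ l ∈ s, M l).map f).sum = ∑ l ∈ s, ((M l).map f).sum :=
  map_sum (Multiset.sumAddMonoidHom.comp (Multiset.mapAddMonoidHom f)) M s

theorem sum_map_product' {α β γ : Type*} [AddCommMonoid γ] (s : Multiset α) (t : Multiset β)
    (f : α × β → γ) :
    ((s ×ˢ t).map f).sum = (s.map fun a => (t.map fun b => f (a, b)).sum).sum := by
  induction s using Multiset.induction with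
  | empty => simp
  | cons a s ih => simp [Multiset.cons_product, ih]

end Multiset

/-! ### Contraction by the inverse powers -/

/-- `A` is invertible and the powers of its inverse tend to zero in operator norm. -/
structure Matrix.HasContractingInverse {d : ℕ} (A : Matrix (Fin d) (Fin d) ℝ) : Prop where
  isUnit_det : IsUnit A.det
  exists_norm_le : ∀ ε : ℝ, 0 < ε → ∃ m₀ : ℕ, ∀ m ≥ m₀, ∀ x : EuclideanSpace ℝ (Fin d),
    ‖Matrix.toEuclideanLin (A⁻¹ ^ m) x‖ ≤ ε * ‖x‖

namespace Matrix

variable {d : ℕ}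

theorem toEuclideanLin_mul_apply (A B : Matrix (Fin d) (Fin d) ℝ) (x : EuclideanSpace ℝ (Fin d)) :
    Matrix.toEuclideanLin (A * B) x = Matrix.toEuclideanLin A (Matrix.toEuclideanLin B x) := by
  simp [Matrix.toEuclideanLin]

theorem toEuclideanLin_one_apply (x : EuclideanSpace ℝ (Fin d)) :
    Matrix.toEuclideanLin (1 : Matrix (Fin d) (Fin d) ℝ) x = x := by
  simp [Matrix.toEuclideanLin]

theorem toEuclideanLin_pow_inv_pow {A : Matrix (Fin d) (Fin d) ℝ} (hA : IsUnit A.det) (m : ℕ)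
    (x : EuclideanSpace ℝ (Fin d)) :
    Matrix.toEuclideanLin (A ^ m) (Matrix.toEuclideanLin (A⁻¹ ^ m) x) = x := by
  rw [← toEuclideanLin_mul_apply, Matrix.inv_pow', Matrix.mul_nonsing_inv,
    toEuclideanLin_one_apply]
  rw [Matrix.det_pow]
  exact hA.pow m

theorem toEuclideanLin_inv_pow_pow {A : Matrix (Fin d) (Fin d) ℝ} (hA : IsUnit A.det) (m : ℕ)
    (x : EuclideanSpace ℝ (Fin d)) :
    Matrix.toEuclideanLin (A⁻¹ ^ m) (Matrix.toEuclideanLin (A ^ m) x) = x := by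
  rw [← toEuclideanLin_mul_apply, Matrix.inv_pow', Matrix.nonsing_inv_mul,
    toEuclideanLin_one_apply]
  rw [Matrix.det_pow]
  exact hA.pow m

theorem exists_norm_toEuclideanLin_le (A : Matrix (Fin d) (Fin d) ℝ) :
    ∃ C : ℝ, 0 ≤ C ∧ ∀ x, ‖Matrix.toEuclideanLin A x‖ ≤ C * ‖x‖ :=
  ⟨_, norm_nonneg (LinearMap.toContinuousLinearMap (Matrix.toEuclideanLin A)),
    fun x => (LinearMap.toContinuousLinearMap (Matrix.toEuclideanLin A)).le_opNorm x⟩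

theorem continuous_toEuclideanLin (A : Matrix (Fin d) (Fin d) ℝ) :
    Continuous (Matrix.toEuclideanLin A) :=
  LinearMap.continuous_of_finiteDimensional _

theorem IsExpanding.hasContractingInverse (hd : 0 < d) {A : Matrix (Fin d) (Fin d) ℝ}
    (hA : A.IsExpanding) : A.HasContractingInverse := by
  obtain ⟨hdet, hlim⟩ := hA.tendsto_inv_pow hd
  refine ⟨hdet, fun ε hε => ?_⟩
  let Φ : Matrix (Fin d) (Fin d) ℝ →ₗ[ℝ]
      (EuclideanSpace ℝ (Fin d) →L[ℝ] EuclideanSpace ℝ (Fin d)) :=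
    LinearMap.toContinuousLinearMap.toLinearMap ∘ₗ Matrix.toEuclideanLin.toLinearMap
  have hΦ : Continuous Φ := LinearMap.continuous_of_finiteDimensional _
  have h0 : Tendsto (fun m : ℕ => A⁻¹ ^ m) atTop (𝓝 0) :=
    tendsto_pi_nhds.2 fun i => tendsto_pi_nhds.2 fun j => hlim i j
  have h1 : Tendsto (fun m : ℕ => ‖Φ (A⁻¹ ^ m)‖) atTop (𝓝 0) := by
    simpa using ((hΦ.tendsto 0).comp h0).norm
  obtain ⟨m₀, hm₀⟩ := eventually_atTop.1 (h1.eventually_lt_const hε)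
  refine ⟨m₀, fun m hm x => ((Φ (A⁻¹ ^ m)).le_opNorm x).trans ?_⟩
  gcongr
  exact (hm₀ m hm).le

theorem HasContractingInverse.pow {A : Matrix (Fin d) (Fin d) ℝ} (hA : A.HasContractingInverse)
    {N : ℕ} (hN : 0 < N) : (A ^ N).HasContractingInverse := by
  refine ⟨by rw [Matrix.det_pow]; exact hA.isUnit_det.pow N, fun ε hε => ?_⟩
  obtain ⟨m₀, hm₀⟩ := hA.exists_norm_le ε hε
  refine ⟨m₀, fun m hm x => ?_⟩
  rw [← Matrix.inv_pow', ← pow_mul]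
  exact hm₀ _ (hm.trans (Nat.le_mul_of_pos_left m hN)) x

theorem volume_image_toEuclideanLin (A : Matrix (Fin d) (Fin d) ℝ)
    (s : Set (EuclideanSpace ℝ (Fin d))) :
    volume (Matrix.toEuclideanLin A '' s) = ENNReal.ofReal |A.det| * volume s := by
  rw [Measure.addHaar_image_linearMap]
  congr 3
  change LinearMap.det (Matrix.toLpLin 2 2 A) = A.det
  rw [Matrix.toLpLin_eq_toLin, LinearMap.det_toLin]

end Matrix

/-! ### Iterated inflation systems -/

namespace InflationSystem

variable {d n : ℕ} {P : InflationSystem d n}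

theorem mem_iterDigits_succ {k : ℕ} {i j : Fin n} {e : EuclideanSpace ℝ (Fin d)} :
    e ∈ P.iterDigits (k + 1) i j ↔ ∃ l, ∃ a ∈ P.iterDigits k i l, ∃ b ∈ P.digits l j,
      a + Matrix.toEuclideanLin (P.mat ^ k) b = e := by
  simp only [iterDigits, Multiset.mem_sum, Finset.mem_univ, true_and, Multiset.mem_map,
    Multiset.mem_product, Prod.exists]
  refine exists_congr fun l => ⟨?_, ?_⟩
  · rintro ⟨a, b, ⟨ha, hb⟩, rfl⟩
    exact ⟨a, ha, b, hb, rfl⟩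
  · rintro ⟨a, ha, b, hb, rfl⟩
    exact ⟨a, b, ⟨ha, hb⟩, rfl⟩

theorem card_iterDigits (k : ℕ) (i j : Fin n) :
    ((P.iterDigits k i j).card : ℝ) = (P.subdivisionMatrix ^ k) i j := by
  induction k generalizing j with
  | zero =>
    by_cases h : i = j <;> simp [iterDigits, h]
  | succ k ih =>
    rw [pow_succ, Matrix.mul_apply]
    simp only [iterDigits, Multiset.card_sum, Multiset.card_map, Multiset.card_product,
      Nat.cast_sum, Nat.cast_mul, ih]
    rfl

theorem subdivisionMatrix_iterate (N : ℕ) :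
    (P.iterate N).subdivisionMatrix = P.subdivisionMatrix ^ N := by
  ext i j
  exact card_iterDigits N i j

theorem isPrimitive_iterate (hP : P.subdivisionMatrix.IsPrimitive) {N : ℕ} (hN : 0 < N) :
    (P.iterate N).subdivisionMatrix.IsPrimitive := by
  rw [subdivisionMatrix_iterate]
  obtain ⟨k, hk0, hk⟩ := hP.exists_pos_pow
  refine ⟨Matrix.pow_apply_nonneg hP.nonneg N, k, hk0, fun i j => ?_⟩
  rw [← pow_mul, mul_comm, pow_mul]
  obtain ⟨N, rfl⟩ : ∃ M, N = M + 1 := ⟨N - 1, by omega⟩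
  clear hN
  induction N generalizing j with
  | zero => simpa using hk i j
  | succ N ih =>
    rw [pow_succ, Matrix.mul_apply]
    exact Finset.sum_pos (fun l _ => mul_pos (ih l) (hk l j)) ⟨i, Finset.mem_univ i⟩

theorem exists_forall_iterDigits_nonempty (hP : P.subdivisionMatrix.IsPrimitive) :
    ∃ k > 0, ∀ i j, ∃ e, e ∈ P.iterDigits k i j := by
  obtain ⟨k, hk0, hk⟩ := hP.exists_pos_pow
  refine ⟨k, hk0, fun i j => Multiset.exists_mem_of_ne_zero fun h => ?_⟩
  have := hk i j
  rw [← card_iterDigits, h] at this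
  simp at this

theorem inflation_iterate_succ (hA : IsUnit P.mat.det) (k : ℕ) (X : MultisetFamily d n) :
    (P.iterate (k + 1)).inflation X = (P.iterate k).inflation (P.inflation X) := by
  ext i x
  have hx : ∀ a b : EuclideanSpace ℝ (Fin d),
      Matrix.toEuclideanLin (P.mat ^ (k + 1))⁻¹
        (x - (a + Matrix.toEuclideanLin (P.mat ^ k) b)) =
      Matrix.toEuclideanLin P.mat⁻¹ (Matrix.toEuclideanLin (P.mat ^ k)⁻¹ (x - a) - b) := by
    intro a b
    rw [← Matrix.inv_pow', pow_succ', Matrix.toEuclideanLin_mul_apply, ← sub_sub, map_sub,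
      Matrix.toEuclideanLin_inv_pow_pow hA, ← Matrix.inv_pow']
  simp only [inflation, iterate, iterDigits, Multiset.sum_map_finset_sum, Multiset.map_map,
    Function.comp_def, Multiset.sum_map_product', hx]
  rw [Finset.sum_comm]
  exact Finset.sum_congr rfl fun l _ => Multiset.sum_map_sum.symm

/-- The iterates of the inflation operator are the inflation operators of the iterated systems. -/
theorem inflation_iterate (hA : IsUnit P.mat.det) (m : ℕ) (X : MultisetFamily d n) :
    P.inflation^[m] X = (P.iterate m).inflation X := by
  induction m generalizing X with
  | zero =>
    ext i x
    simp only [Function.iterate_zero, id, inflation, iterate, iterDigits, pow_zero, inv_one]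
    rw [Finset.sum_eq_single i (fun j _ hj => by simp [hj.symm]) (by simp)]
    simp
  | succ m ih => rw [Function.iterate_succ_apply, ih, inflation_iterate_succ hA]

/-! ### Existence and uniqueness of solutions of the multi-tile equation -/

variable {T : Fin n → Set (EuclideanSpace ℝ (Fin d))}

theorem IsCompactMultiTileSolution.mem_image_iff (hT : P.IsCompactMultiTileSolution T) {i : Fin n}
    {y : EuclideanSpace ℝ (Fin d)} :
    (∃ x ∈ T i, Matrix.toEuclideanLin P.mat x = y) ↔
      ∃ j, ∃ t ∈ T j, ∃ e ∈ P.digits j i, t + e = y := by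
  have := Set.ext_iff.1 (hT.2.2 i) y
  simpa only [Set.mem_image, Set.mem_iUnion, Set.mem_add, Set.mem_ofPred_eq] using this

theorem IsCompactMultiTileSolution.iterate (hT : P.IsCompactMultiTileSolution T) (m : ℕ) :
    (P.iterate m).IsCompactMultiTileSolution T := by
  refine ⟨hT.1, hT.2.1, ?_⟩
  suffices H : ∀ m i y, (∃ x ∈ T i, Matrix.toEuclideanLin (P.mat ^ m) x = y) ↔
      ∃ j, ∃ t ∈ T j, ∃ e ∈ P.iterDigits m j i, t + e = y by
    intro i
    ext y
    simp only [Set.mem_image, Set.mem_iUnion, Set.mem_add, Set.mem_ofPred_eq]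
    exact H m i y
  clear m
  intro m
  induction m with
  | zero =>
    intro i y
    have hmem : ∀ j e, e ∈ P.iterDigits 0 j i ↔ j = i ∧ e = 0 := by
      intro j e
      by_cases h : j = i <;> simp [iterDigits, h]
    simp [hmem]
  | succ m ih =>
    intro i y
    constructor
    · rintro ⟨x, hx, rfl⟩
      obtain ⟨l, s, hs, b, hb, hsb⟩ := hT.mem_image_iff.1 ⟨x, hx, rfl⟩
      obtain ⟨j, u, hu, a, ha, hua⟩ := (ih l _).1 ⟨s, hs, rfl⟩
      refine ⟨j, u, hu, _, mem_iterDigits_succ.2 ⟨l, a, ha, b, hb, rfl⟩, ?_⟩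
      rw [pow_succ, Matrix.toEuclideanLin_mul_apply, ← hsb, map_add, ← hua, add_assoc]
    · rintro ⟨j, u, hu, e, he, rfl⟩
      obtain ⟨l, a, ha, b, hb, rfl⟩ := mem_iterDigits_succ.1 he
      obtain ⟨s, hs, hsu⟩ := (ih l _).2 ⟨j, u, hu, a, ha, rfl⟩
      obtain ⟨x, hx, hxs⟩ := hT.mem_image_iff.2 ⟨l, s, hs, b, hb, rfl⟩
      refine ⟨x, hx, ?_⟩
      rw [pow_succ, Matrix.toEuclideanLin_mul_apply, hxs, map_add, hsu, add_assoc]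

/-- Points of `Aᵐ T_i` are the points `t + e` with `t ∈ T_j` and `e ∈ D^m_ji`. -/
theorem IsCompactMultiTileSolution.mem_image_iterate_iff (hT : P.IsCompactMultiTileSolution T)
    {m : ℕ} {i : Fin n} {y : EuclideanSpace ℝ (Fin d)} :
    (∃ x ∈ T i, Matrix.toEuclideanLin (P.mat ^ m) x = y) ↔
      ∃ j, ∃ t ∈ T j, ∃ e ∈ P.iterDigits m j i, t + e = y :=
  (hT.iterate m).mem_image_iff

theorem IsCompactMultiTileSolution.forall_nonempty (hT : P.IsCompactMultiTileSolution T)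
    (hP : P.subdivisionMatrix.IsPrimitive) (i : Fin n) : (T i).Nonempty := by
  obtain ⟨k, -, hk⟩ := exists_forall_iterDigits_nonempty hP
  obtain ⟨j, t, ht⟩ := hT.2.1
  obtain ⟨e, he⟩ := hk j i
  obtain ⟨x, hx, -⟩ := hT.mem_image_iterate_iff.2 ⟨j, t, ht, e, he, rfl⟩
  exact ⟨x, hx⟩

theorem exists_bound_of_isCompact (hT : ∀ i, IsCompact (T i)) :
    ∃ R : ℝ, 0 < R ∧ ∀ i, ∀ t ∈ T i, ‖t‖ ≤ R := by
  obtain ⟨R, hR, hR'⟩ := (isCompact_iUnion hT).isBounded.exists_pos_norm_le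
  exact ⟨R, hR, fun i t ht => hR' t (Set.mem_iUnion.2 ⟨i, ht⟩)⟩

/-- Any two solutions with nonempty members agree: a point of the first is followed through `m`
subdivisions, and its digits determine a point of the second at distance `O(‖A⁻ᵐ‖)`. -/
theorem IsCompactMultiTileSolution.subset (hA : P.mat.HasContractingInverse)
    {T' : Fin n → Set (EuclideanSpace ℝ (Fin d))}
    (hT : P.IsCompactMultiTileSolution T) (hT' : P.IsCompactMultiTileSolution T')
    (hne : ∀ i, (T' i).Nonempty) (i : Fin n) : T i ⊆ T' i := by
  intro x hx
  obtain ⟨R, hR, hTR⟩ := exists_bound_of_isCompact hT.1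
  obtain ⟨R', hR', hTR'⟩ := exists_bound_of_isCompact hT'.1
  rw [← (hT'.1 i).isClosed.closure_eq, Metric.mem_closure_iff]
  intro ε hε
  obtain ⟨m, hm⟩ := hA.exists_norm_le (ε / (2 * (R + R'))) (by positivity)
  obtain ⟨j, t, ht, e, he, hte⟩ := hT.mem_image_iterate_iff (m := m).1 ⟨x, hx, rfl⟩
  obtain ⟨t', ht'⟩ := hne j
  obtain ⟨x', hx', hxe⟩ := hT'.mem_image_iterate_iff.2 ⟨j, t', ht', e, he, rfl⟩
  refine ⟨x', hx', ?_⟩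
  have h1 : x - x' = Matrix.toEuclideanLin (P.mat⁻¹ ^ m) (t - t') := by
    rw [← Matrix.toEuclideanLin_inv_pow_pow hA.isUnit_det m (x - x'), map_sub, ← hte, hxe]
    congr 1
    abel
  rw [dist_eq_norm, h1]
  refine (hm m le_rfl _).trans_lt ?_
  calc ε / (2 * (R + R')) * ‖t - t'‖ ≤ ε / (2 * (R + R')) * (R + R') := by
        gcongr
        exact (norm_sub_le _ _).trans (add_le_add (hTR _ _ ht) (hTR' _ _ ht'))
    _ = ε / 2 := by field_simp
    _ < ε := by linarith

theorem IsCompactMultiTileSolution.isUnique (hA : P.mat.HasContractingInverse)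
    (hP : P.subdivisionMatrix.IsPrimitive) (hT : P.IsCompactMultiTileSolution T) :
    P.IsUniqueCompactMultiTileSolution T :=
  ⟨hT, fun _ hT' => funext fun i => (hT'.subset hA hT (hT.forall_nonempty hP) i).antisymm
    (hT.subset hA hT' (hT'.forall_nonempty hP) i)⟩

/-- An adapted gauge of the contraction `A⁻¹`: it dominates the norm, is dominated by a multiple of
the norm, and decreases by at least half the norm when `A⁻¹` is applied. -/
theorem _root_.Matrix.HasContractingInverse.exists_gauge {A : Matrix (Fin d) (Fin d) ℝ}
    (hA : A.HasContractingInverse) :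
    ∃ q : EuclideanSpace ℝ (Fin d) → ℝ, Continuous q ∧ (∀ x y, q (x + y) ≤ q x + q y) ∧
      q 0 = 0 ∧ (∀ x, ‖x‖ ≤ q x) ∧ (∃ C : ℝ, 1 ≤ C ∧ ∀ x, q x ≤ C * ‖x‖) ∧
      ∀ x, q (Matrix.toEuclideanLin A⁻¹ x) ≤ q x - ‖x‖ / 2 := by
  obtain ⟨m₀, hm₀⟩ := hA.exists_norm_le (1 / 2) (by norm_num)
  choose C hC0 hC using fun l : ℕ => Matrix.exists_norm_toEuclideanLin_le (A⁻¹ ^ l)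
  refine ⟨fun x => ∑ l ∈ Finset.range (m₀ + 1), ‖Matrix.toEuclideanLin (A⁻¹ ^ l) x‖,
    continuous_finsetSum _ fun l _ => (Matrix.continuous_toEuclideanLin _).norm,
    fun x y => ?_, by simp, fun x => ?_, ⟨1 + ∑ l ∈ Finset.range (m₀ + 1), C l, ?_, fun x => ?_⟩,
    fun x => ?_⟩
  · rw [← Finset.sum_add_distrib]
    exact Finset.sum_le_sum fun l _ => by rw [map_add]; exact norm_add_le _ _
  · change _ ≤ ∑ l ∈ Finset.range (m₀ + 1), ‖Matrix.toEuclideanLin (A⁻¹ ^ l) x‖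
    rw [Finset.sum_range_succ', pow_zero, Matrix.toEuclideanLin_one_apply]
    exact le_add_of_nonneg_left (Finset.sum_nonneg fun _ _ => norm_nonneg _)
  · exact le_add_of_nonneg_right (Finset.sum_nonneg fun l _ => hC0 l)
  · rw [add_mul, Finset.sum_mul]
    exact (Finset.sum_le_sum fun l _ => hC l x).trans
      (le_add_of_nonneg_left (by positivity))
  · have h1 : ∀ l, Matrix.toEuclideanLin (A⁻¹ ^ l) (Matrix.toEuclideanLin A⁻¹ x) =
        Matrix.toEuclideanLin (A⁻¹ ^ (l + 1)) x := fun l => by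
      rw [pow_succ, Matrix.toEuclideanLin_mul_apply]
    simp only [h1]
    rw [Finset.sum_range_succ, Finset.sum_range_succ' _ m₀, pow_zero,
      Matrix.toEuclideanLin_one_apply]
    have := hm₀ (m₀ + 1) (by omega) x
    linarith

/-- The set map whose fixed points are the solutions of the multi-tile equation. -/
noncomputable def tileMap (P : InflationSystem d n) (K : Fin n → Set (EuclideanSpace ℝ (Fin d))) :
    Fin n → Set (EuclideanSpace ℝ (Fin d)) := fun i =>
  ⋃ j, ⋃ e ∈ {e | e ∈ P.digits j i}, (fun t => Matrix.toEuclideanLin P.mat⁻¹ (t + e)) '' K j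

theorem mem_tileMap (hA : IsUnit P.mat.det) {K : Fin n → Set (EuclideanSpace ℝ (Fin d))}
    {i : Fin n} {x : EuclideanSpace ℝ (Fin d)} :
    x ∈ P.tileMap K i ↔
      ∃ j, ∃ t ∈ K j, ∃ e ∈ P.digits j i, t + e = Matrix.toEuclideanLin P.mat x := by
  have hinv := Matrix.toEuclideanLin_inv_pow_pow hA 1
  have hinv' := Matrix.toEuclideanLin_pow_inv_pow hA 1
  simp only [pow_one] at hinv hinv'
  simp only [tileMap, Set.mem_iUnion, Set.mem_image, Set.mem_ofPred_eq]
  refine exists_congr fun j => ⟨?_, ?_⟩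
  · rintro ⟨e, he, t, ht, rfl⟩
    exact ⟨t, ht, e, he, (hinv' _).symm⟩
  · rintro ⟨t, ht, e, he, h⟩
    exact ⟨e, he, t, ht, by rw [h, hinv]⟩

theorem finite_setOf_mem_digits (P : InflationSystem d n) (i j : Fin n) :
    {e | e ∈ P.digits i j}.Finite := by
  classical
  exact (P.digits i j).toFinset.finite_toSet.subset fun e he => by simpa using he

theorem isCompact_tileMap {K : Fin n → Set (EuclideanSpace ℝ (Fin d))} (hK : ∀ i, IsCompact (K i))
    (i : Fin n) : IsCompact (P.tileMap K i) :=
  isCompact_iUnion fun j => (P.finite_setOf_mem_digits j i).isCompact_biUnion fun _ _ =>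
    (hK j).image ((Matrix.continuous_toEuclideanLin _).comp (continuous_id.add continuous_const))

theorem tileMap_mono {K K' : Fin n → Set (EuclideanSpace ℝ (Fin d))} (h : K ≤ K') :
    P.tileMap K ≤ P.tileMap K' := fun _ =>
  Set.iUnion_mono fun j => Set.iUnion₂_mono fun _ _ => Set.image_mono (h j)

/-- A large sublevel set of the adapted gauge is preserved by the tile map. -/
theorem exists_compact_tileMap_subset (hA : P.mat.HasContractingInverse) :
    ∃ K : Set (EuclideanSpace ℝ (Fin d)), IsCompact K ∧ K.Nonempty ∧
      P.tileMap (fun _ => K) ≤ fun _ => K := by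
  obtain ⟨q, hqc, hqadd, hq0, hqle, ⟨C, hC1, hqC⟩, hqA⟩ := hA.exists_gauge
  have hqnn : ∀ x, 0 ≤ q x := fun x => (norm_nonneg x).trans (hqle x)
  obtain ⟨Q, hQ⟩ : ∃ Q : ℝ, ∀ i j, ∀ e ∈ P.digits i j, q e ≤ Q := by
    have hfin : (⋃ i, ⋃ j, q '' {e | e ∈ P.digits i j}).Finite :=
      Set.finite_iUnion fun i => Set.finite_iUnion fun j =>
        (P.finite_setOf_mem_digits i j).image q
    obtain ⟨Q, hQ⟩ := hfin.bddAbove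
    exact ⟨Q, fun i j e he => hQ (Set.mem_iUnion₂.2 ⟨i, j, e, he, rfl⟩)⟩
  -- The radius is chosen so that the loss `‖x‖ / 2 ≥ q x / (2 * C)` under `A⁻¹` compensates the
  -- digit, whose gauge is at most `Q`.
  refine ⟨{x | q x ≤ 2 * C * |Q|}, ?_, ⟨0, ?_⟩, ?_⟩
  · refine Metric.isCompact_of_isClosed_isBounded (isClosed_le hqc continuous_const) ?_
    exact (Metric.isBounded_closedBall (x := (0 : EuclideanSpace ℝ (Fin d)))
      (r := 2 * C * |Q|)).subset fun x hx => by
        simpa using (hqle x).trans hx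
  · change q 0 ≤ _
    rw [hq0]
    positivity
  · intro i x hx
    simp only [tileMap, Set.mem_iUnion, Set.mem_image, Set.mem_ofPred_eq] at hx
    obtain ⟨j, e, he, t, ht, rfl⟩ := hx
    change q _ ≤ _
    refine (hqA _).trans ?_
    have h1 := hqadd t e
    have h2 := (hQ _ _ e he).trans (le_abs_self Q)
    have h3 := hqC (t + e)
    have h4 : q (t + e) / (2 * C) ≤ ‖t + e‖ / 2 := by
      rw [div_le_iff₀ (by positivity)]
      linarith
    have h5 : q (t + e) * (1 - 1 / (2 * C)) ≤ (2 * C * |Q| + |Q|) * (1 - 1 / (2 * C)) := by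
      refine mul_le_mul_of_nonneg_right (by linarith) ?_
      rw [sub_nonneg, div_le_one (by positivity)]
      linarith
    have h6 : (2 * C * |Q| + |Q|) * (1 - 1 / (2 * C)) = 2 * C * |Q| - |Q| / (2 * C) := by
      field_simp
      ring
    have h7 : 0 ≤ |Q| / (2 * C) := by positivity
    have h8 : q (t + e) * (1 - 1 / (2 * C)) = q (t + e) - q (t + e) / (2 * C) := by ring
    linarith

/-- Existence of a compact solution: the tile map preserves a large compact set, and the solution is
the decreasing intersection of the images of that set. -/
theorem exists_isCompactMultiTileSolution (hn : 0 < n) (hA : P.mat.HasContractingInverse)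
    (hD : ∀ i, ∃ j e, e ∈ P.digits j i) : ∃ T, P.IsCompactMultiTileSolution T := by
  obtain ⟨K, hK, hKne, hKF⟩ := exists_compact_tileMap_subset hA
  set S : ℕ → Fin n → Set (EuclideanSpace ℝ (Fin d)) := fun k => P.tileMap^[k] fun _ => K with hS
  have hS1 : ∀ k, S (k + 1) = P.tileMap (S k) := fun k => Function.iterate_succ_apply' _ _ _
  have hcomp : ∀ k i, IsCompact (S k i) := by
    intro k
    induction k with
    | zero => exact fun _ => hK
    | succ k ih =>
      rw [hS1]
      exact isCompact_tileMap ih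
  have hne : ∀ k i, (S k i).Nonempty := by
    intro k
    induction k with
    | zero => exact fun _ => hKne
    | succ k ih =>
      intro i
      obtain ⟨j, e, he⟩ := hD i
      obtain ⟨t, ht⟩ := ih j
      rw [hS1]
      exact ⟨_, Set.mem_iUnion.2 ⟨j, Set.mem_iUnion₂.2 ⟨e, he, t, ht, rfl⟩⟩⟩
  have hdec : ∀ k, S (k + 1) ≤ S k := by
    intro k
    induction k with
    | zero => exact hKF
    | succ k ih =>
      rw [hS1 (k + 1)]
      conv_rhs => rw [hS1 k]
      exact tileMap_mono ih
  have hanti : Antitone S := antitone_nat_of_succ_le hdec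
  refine ⟨fun i => ⋂ k, S k i, fun i => ?_, ⟨⟨0, hn⟩, ?_⟩, fun i => ?_⟩
  · exact (hcomp 0 i).of_isClosed_subset (isClosed_iInter fun k => (hcomp k i).isClosed)
      (Set.iInter_subset _ 0)
  · exact IsCompact.nonempty_iInter_of_sequence_nonempty_isCompact_isClosed _
      (fun k => hdec k _) (fun k => hne k _) (hcomp 0 _) fun k => (hcomp k _).isClosed
  · ext y
    simp only [Set.mem_image, Set.mem_iUnion, Set.mem_add, Set.mem_ofPred_eq, Set.mem_iInter]
    constructor
    · rintro ⟨x, hx, rfl⟩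
      by_contra! hcon
      -- Each of the finitely many pairs (tile, digit) fails from some step on.
      let I := {p : Fin n × EuclideanSpace ℝ (Fin d) // p.2 ∈ P.digits p.1 i}
      have hI : Finite I := by
        have : {p : Fin n × EuclideanSpace ℝ (Fin d) | p.2 ∈ P.digits p.1 i}.Finite := by
          refine (Set.finite_iUnion fun j : Fin n =>
            (P.finite_setOf_mem_digits j i).image (Prod.mk j)).subset ?_
          rintro ⟨j, e⟩ he
          exact Set.mem_iUnion.2 ⟨j, e, he, rfl⟩
        exact this.to_subtype
      have hfail : ∀ p : I, ∃ k, Matrix.toEuclideanLin P.mat x - p.1.2 ∉ S k p.1.1 := by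
        intro p
        by_contra! h
        exact hcon p.1.1 _ h p.1.2 p.2 (sub_add_cancel _ _)
      choose κ hκ using hfail
      obtain ⟨k, hk⟩ := (Set.finite_range κ).bddAbove
      have hxk := hx (k + 1)
      rw [hS1, mem_tileMap hA.isUnit_det] at hxk
      obtain ⟨j, t, ht, e, he, hte⟩ := hxk
      refine hκ ⟨(j, e), he⟩ (hanti (hk ⟨⟨(j, e), he⟩, rfl⟩) j ?_)
      rwa [← hte, add_sub_cancel_right]
    · rintro ⟨j, t, ht, e, he, rfl⟩
      have hinv' := Matrix.toEuclideanLin_pow_inv_pow hA.isUnit_det 1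
      simp only [pow_one] at hinv'
      refine ⟨Matrix.toEuclideanLin P.mat⁻¹ (t + e), fun k => hdec k i ?_, hinv' _⟩
      rw [hS1, mem_tileMap hA.isUnit_det]
      exact ⟨j, t, ht k, e, he, (hinv' _).symm⟩

end InflationSystem

/-! ### Covering multiplicities -/

section CoverCount

variable {d n : ℕ}

/-- The number of translates `e + T_j`, with `e` running through the multiset `D_j`, that contain
`y`, as an extended nonnegative real. -/
noncomputable def coverCount (T : Fin n → Set (EuclideanSpace ℝ (Fin d)))
    (D : Fin n → Multiset (EuclideanSpace ℝ (Fin d))) (y : EuclideanSpace ℝ (Fin d)) : ℝ≥0∞ :=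
  ∑ j, ((D j).map fun e => (e +ᵥ T j).indicator 1 y).sum

theorem measurable_sum_map_indicator_vadd {U : Set (EuclideanSpace ℝ (Fin d))}
    (hU : MeasurableSet U) (D : Multiset (EuclideanSpace ℝ (Fin d))) :
    Measurable fun y =>
      (D.map fun e => (e +ᵥ U).indicator (1 : EuclideanSpace ℝ (Fin d) → ℝ≥0∞) y).sum := by
  induction D using Multiset.induction with
  | empty => simp
  | cons a D ih =>
    simp only [Multiset.map_cons, Multiset.sum_cons]
    exact (measurable_one.indicator (hU.const_vadd a)).add ih

theorem lintegral_sum_map_indicator_vadd {U : Set (EuclideanSpace ℝ (Fin d))}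
    (hU : MeasurableSet U) (D : Multiset (EuclideanSpace ℝ (Fin d))) :
    ∫⁻ y, (D.map fun e => (e +ᵥ U).indicator (1 : EuclideanSpace ℝ (Fin d) → ℝ≥0∞) y).sum =
      D.card * volume U := by
  induction D using Multiset.induction with
  | empty => simp
  | cons a D ih =>
    simp only [Multiset.map_cons, Multiset.sum_cons]
    rw [lintegral_add_left (measurable_one.indicator (hU.const_vadd a)), ih,
      lintegral_indicator_one (hU.const_vadd a), measure_vadd, Multiset.card_cons]
    push_cast
    ring

theorem measurable_coverCount {T : Fin n → Set (EuclideanSpace ℝ (Fin d))}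
    (hT : ∀ j, MeasurableSet (T j)) (D : Fin n → Multiset (EuclideanSpace ℝ (Fin d))) :
    Measurable (coverCount T D) :=
  Finset.measurable_fun_sum _ fun j _ => measurable_sum_map_indicator_vadd (hT j) (D j)

theorem lintegral_coverCount {T : Fin n → Set (EuclideanSpace ℝ (Fin d))}
    (hT : ∀ j, MeasurableSet (T j)) (D : Fin n → Multiset (EuclideanSpace ℝ (Fin d))) :
    ∫⁻ y, coverCount T D y = ∑ j, (D j).card * volume (T j) := by
  simp only [coverCount]
  rw [lintegral_finsetSum _ fun j _ => measurable_sum_map_indicator_vadd (hT j) (D j)]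
  exact Finset.sum_congr rfl fun j _ => lintegral_sum_map_indicator_vadd (hT j) (D j)

theorem Multiset.add_le_sum_map {α : Type*} [DecidableEq α] {D : Multiset α} (f : α → ℝ≥0∞)
    {a b : α} (ha : a ∈ D) (hb : b ∈ D.erase a) : f a + f b ≤ (D.map f).sum := by
  rw [← Multiset.cons_erase ha, ← Multiset.cons_erase hb]
  simp only [Multiset.map_cons, Multiset.sum_cons, ← add_assoc]
  exact le_self_add

theorem sum_map_indicator_le_coverCount (T : Fin n → Set (EuclideanSpace ℝ (Fin d)))
    (D : Fin n → Multiset (EuclideanSpace ℝ (Fin d))) (y : EuclideanSpace ℝ (Fin d)) (j : Fin n) :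
    ((D j).map fun e => (e +ᵥ T j).indicator 1 y).sum ≤ coverCount T D y :=
  Finset.single_le_sum
    (f := fun j =>
      ((D j).map fun e => (e +ᵥ T j).indicator (1 : EuclideanSpace ℝ (Fin d) → ℝ≥0∞) y).sum)
    (fun _ _ => zero_le) (Finset.mem_univ j)

theorem one_le_coverCount {T : Fin n → Set (EuclideanSpace ℝ (Fin d))}
    {D : Fin n → Multiset (EuclideanSpace ℝ (Fin d))} {y : EuclideanSpace ℝ (Fin d)} {j : Fin n}
    {e : EuclideanSpace ℝ (Fin d)} (he : e ∈ D j) (hy : y ∈ e +ᵥ T j) :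
    1 ≤ coverCount T D y := by
  refine le_trans ?_ (sum_map_indicator_le_coverCount T D y j)
  refine le_trans ?_ (Multiset.single_le_sum (fun _ _ => zero_le) _
    (Multiset.mem_map_of_mem _ he))
  simp [hy]

theorem eq_of_coverCount_le_one {T : Fin n → Set (EuclideanSpace ℝ (Fin d))}
    {D : Fin n → Multiset (EuclideanSpace ℝ (Fin d))} {y : EuclideanSpace ℝ (Fin d)}
    (h : coverCount T D y ≤ 1) {j j' : Fin n} {e e' : EuclideanSpace ℝ (Fin d)}
    (he : e ∈ D j) (hy : y ∈ e +ᵥ T j) (he' : e' ∈ D j') (hy' : y ∈ e' +ᵥ T j') :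
    (j, e) = (j', e') := by
  classical
  have h2 : ¬ ((1 : ℝ≥0∞) + 1 ≤ 1) := by norm_num
  by_contra hne
  refine h2 (le_trans ?_ h)
  by_cases hj : j = j'
  · subst hj
    have hee : e' ≠ e := fun h => hne (by rw [h])
    refine le_trans ?_ (sum_map_indicator_le_coverCount T D y j)
    refine le_trans (le_of_eq ?_) (Multiset.add_le_sum_map _ he
      ((Multiset.mem_erase_of_ne hee).2 he'))
    simp [hy, hy']
  · have hs : ∀ k a, a ∈ D k → y ∈ a +ᵥ T k →
        (1 : ℝ≥0∞) ≤ ((D k).map fun e => (e +ᵥ T k).indicator 1 y).sum := fun k a ha hya =>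
      le_trans (by simp [hya]) (Multiset.single_le_sum (fun _ _ => zero_le) _
        (Multiset.mem_map_of_mem _ ha))
    calc (1 : ℝ≥0∞) + 1 ≤ ∑ k ∈ {j, j'},
          ((D k).map fun e => (e +ᵥ T k).indicator 1 y).sum := by
          rw [Finset.sum_pair hj]
          exact add_le_add (hs j e he hy) (hs j' e' he' hy')
      _ ≤ _ := Finset.sum_le_sum_of_subset (Finset.subset_univ _)

theorem count_le_one_of_coverCount_le_one [DecidableEq (EuclideanSpace ℝ (Fin d))]
    {T : Fin n → Set (EuclideanSpace ℝ (Fin d))}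
    {D : Fin n → Multiset (EuclideanSpace ℝ (Fin d))} {y : EuclideanSpace ℝ (Fin d)}
    (h : coverCount T D y ≤ 1) {j : Fin n} {e : EuclideanSpace ℝ (Fin d)} (hy : y ∈ e +ᵥ T j) :
    (D j).count e ≤ 1 := by
  have h2 : ¬ ((1 : ℝ≥0∞) + 1 ≤ 1) := by norm_num
  by_contra! hlt
  refine h2 (le_trans ?_ h)
  refine le_trans ?_ (sum_map_indicator_le_coverCount T D y j)
  refine le_trans (le_of_eq ?_) (Multiset.add_le_sum_map (a := e) (b := e) _
    (Multiset.count_pos.1 (by omega)) (Multiset.count_pos.1 ?_))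
  · simp [hy]
  · rw [Multiset.count_erase_self]
    omega

end CoverCount

namespace InflationSystem

variable {d n : ℕ} {P : InflationSystem d n}

/-! ### Weakly uniformly discrete solutions give tiles of positive measure -/

theorem _root_.Multiset.countP_le_sum_map {α : Type*} (p : α → Prop) [DecidablePred p]
    (D : Multiset α) (f : α → ℕ) (h : ∀ a, p a → 1 ≤ f a) : D.countP p ≤ (D.map f).sum := by
  induction D using Multiset.induction with
  | empty => simp
  | cons a D ih =>
    rw [Multiset.map_cons, Multiset.sum_cons]
    by_cases hp : p a
    · rw [Multiset.countP_cons_of_pos _ hp]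
      linarith [h a hp]
    · rw [Multiset.countP_cons_of_neg _ hp]
      linarith

/-- The image of one point of `X_j` under the `m`-th iterate is a copy of the multiset `D^m_ij`
inside the fixed family. -/
theorem count_iterDigits_le [DecidableEq (EuclideanSpace ℝ (Fin d))] (hA : IsUnit P.mat.det)
    {m : ℕ} {X : MultisetFamily d n}
    (hX : P.inflation^[m] X = X) {j : Fin n} {x₀ : EuclideanSpace ℝ (Fin d)} (hx₀ : X j x₀ ≠ 0)
    (i : Fin n) (e : EuclideanSpace ℝ (Fin d)) :
    (P.iterDigits m i j).count e ≤ X i (e + Matrix.toEuclideanLin (P.mat ^ m) x₀) := by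
  rw [inflation_iterate hA] at hX
  conv_rhs => rw [← hX]
  simp only [inflation, iterate]
  refine le_trans ?_ (Finset.single_le_sum (f := fun j => ((P.iterDigits m i j).map fun a =>
    X j (Matrix.toEuclideanLin (P.mat ^ m)⁻¹
      (e + Matrix.toEuclideanLin (P.mat ^ m) x₀ - a))).sum) (fun _ _ => zero_le)
    (Finset.mem_univ j))
  refine Multiset.countP_le_sum_map _ _ _ ?_
  rintro a rfl
  rw [add_sub_cancel_left, ← Matrix.inv_pow', Matrix.toEuclideanLin_inv_pow_pow hA]
  exact Nat.one_le_iff_ne_zero.2 hx₀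

theorem card_filter_iterDigits_le (hA : IsUnit P.mat.det) {X : MultisetFamily d n}
    {r : ℝ} {M : ℕ} (hM : ∀ (c : EuclideanSpace ℝ (Fin d)) (s : Finset (EuclideanSpace ℝ (Fin d))),
      (s : Set (EuclideanSpace ℝ (Fin d))) ⊆ Metric.ball c r → ∑ x ∈ s, ∑ i, X i x ≤ M)
    {m : ℕ} (hX : P.inflation^[m] X = X) {j : Fin n} {x₀ : EuclideanSpace ℝ (Fin d)}
    (hx₀ : X j x₀ ≠ 0) (i : Fin n) (c : EuclideanSpace ℝ (Fin d))
    [DecidablePred (· ∈ Metric.ball c r)] :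
    ((P.iterDigits m i j).filter (· ∈ Metric.ball c r)).card ≤ M := by
  classical
  set F := (P.iterDigits m i j).filter (· ∈ Metric.ball c r) with hF
  set b := Matrix.toEuclideanLin (P.mat ^ m) x₀
  rw [← Multiset.toFinset_sum_count_eq]
  calc ∑ a ∈ F.toFinset, F.count a ≤ ∑ a ∈ F.toFinset, X i (a + b) :=
        Finset.sum_le_sum fun a _ => (Multiset.count_le_of_le a (Multiset.filter_le _ _)).trans
          (count_iterDigits_le hA hX hx₀ i a)
    _ = ∑ x ∈ F.toFinset.map (addRightEmbedding b), X i x := by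
        rw [Finset.sum_map]
        rfl
    _ ≤ ∑ x ∈ F.toFinset.map (addRightEmbedding b), ∑ i, X i x :=
        Finset.sum_le_sum fun x _ => Finset.single_le_sum (f := fun i => X i x)
          (fun _ _ => zero_le) (Finset.mem_univ i)
    _ ≤ M := by
        refine hM (c + b) _ fun x hx => ?_
        simp only [Finset.coe_map, Set.mem_image, Finset.mem_coe, Multiset.mem_toFinset, hF,
          Multiset.mem_filter] at hx
        obtain ⟨a, ⟨-, ha⟩, rfl⟩ := hx
        simpa using ha

/-- If every ball of radius `r` contains at most `M` elements of `D`, the balls of radius `r` around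
these elements overlap at most `M`-fold. -/
theorem card_mul_volume_ball_le {r : ℝ} {M : ℕ} {D : Multiset (EuclideanSpace ℝ (Fin d))}
    (hD : ∀ c, ∀ [DecidablePred (· ∈ Metric.ball c r)],
      (D.filter (· ∈ Metric.ball c r)).card ≤ M) :
    D.card * volume (Metric.ball (0 : EuclideanSpace ℝ (Fin d)) r) ≤
      M * volume (⋃ e ∈ {e | e ∈ D}, Metric.ball e r) := by
  classical
  have hopen : MeasurableSet (⋃ e ∈ {e | e ∈ D}, Metric.ball e r) :=
    (isOpen_biUnion fun _ _ => Metric.isOpen_ball).measurableSet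
  rw [← lintegral_sum_map_indicator_vadd Metric.isOpen_ball.measurableSet,
    ← lintegral_indicator_one hopen, ← lintegral_const_mul _ (measurable_one.indicator hopen)]
  refine lintegral_mono fun y => ?_
  have hmem : ∀ e : EuclideanSpace ℝ (Fin d),
      y ∈ e +ᵥ Metric.ball (0 : EuclideanSpace ℝ (Fin d)) r ↔ e ∈ Metric.ball y r := by
    intro e
    rw [Metric.vadd_ball, vadd_eq_add, add_zero, Metric.mem_ball_comm]
  have hsum : ∀ D' : Multiset (EuclideanSpace ℝ (Fin d)),
      (D'.map fun e => (e +ᵥ Metric.ball (0 : EuclideanSpace ℝ (Fin d)) r).indicator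
        (1 : EuclideanSpace ℝ (Fin d) → ℝ≥0∞) y).sum =
          ((D'.filter (· ∈ Metric.ball y r)).card : ℝ≥0∞) := by
    intro D'
    induction D' using Multiset.induction with
    | empty => simp
    | cons a D' ih =>
      rw [Multiset.map_cons, Multiset.sum_cons, ih]
      by_cases h : a ∈ Metric.ball y r
      · rw [Multiset.filter_cons_of_pos _ h, Set.indicator_of_mem ((hmem a).2 h),
          Multiset.card_cons]
        push_cast
        rw [Pi.one_apply, add_comm]
      · rw [Multiset.filter_cons_of_neg _ h, Set.indicator_of_notMem (fun h' => h ((hmem a).1 h')),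
          zero_add]
  rw [hsum]
  by_cases h : y ∈ ⋃ e ∈ {e | e ∈ D}, Metric.ball e r
  · rw [Set.indicator_of_mem h, Pi.one_apply, mul_one]
    exact Nat.cast_le.2 (hD y)
  · have h0 : (D.filter (· ∈ Metric.ball y r)).card = 0 := by
      rw [Multiset.card_eq_zero, Multiset.filter_eq_nil]
      intro e he hey
      exact h (Set.mem_iUnion₂.2 ⟨e, he, Metric.mem_ball_comm.1 hey⟩)
    rw [h0, Nat.cast_zero]
    exact zero_le

theorem IsCompactMultiTileSolution.volume_pos_of_volume_pos
    {T : Fin n → Set (EuclideanSpace ℝ (Fin d))}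
    (hT : P.IsCompactMultiTileSolution T) (hP : P.subdivisionMatrix.IsPrimitive) {j : Fin n}
    (hj : 0 < volume (T j)) (i : Fin n) : 0 < volume (T i) := by
  obtain ⟨k, -, hk⟩ := exists_forall_iterDigits_nonempty hP
  obtain ⟨e, he⟩ := hk j i
  have hsub : e +ᵥ T j ⊆ Matrix.toEuclideanLin (P.mat ^ k) '' T i := by
    rintro _ ⟨t, ht, rfl⟩
    obtain ⟨x, hx, hxt⟩ := hT.mem_image_iterate_iff.2 ⟨j, t, ht, e, he, rfl⟩
    exact ⟨x, hx, by rw [hxt]; exact add_comm _ _⟩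
  have h := measure_mono (μ := volume) hsub
  rw [measure_vadd, Matrix.volume_image_toEuclideanLin] at h
  by_contra h0
  rw [nonpos_iff_eq_zero.1 (not_lt.1 h0), mul_zero] at h
  exact absurd hj (not_lt.2 h)

/-- A weakly uniformly discrete family fixed by a power of the inflation operator forces the tiles
to have positive measure. The digit multisets `D^m_ij` then have bounded local multiplicity and at
least `c |det A|^m` elements, so balls of fixed radius around them fill a volume of order
`|det A|^m`; scaled back by `A⁻ᵐ` these balls lie close to the tile. -/
theorem volume_pos_of_isWeaklyUniformlyDiscrete (hn : 0 < n) (hA : P.mat.HasContractingInverse)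
    (hP : P.subdivisionMatrix.IsPrimitive)
    (hperron : P.subdivisionMatrix.perronEigenvalue = |P.mat.det|)
    {N : ℕ} (hN : 0 < N) {X : MultisetFamily d n} (hXne : X.IsNonempty)
    (hXd : X.IsWeaklyUniformlyDiscrete) (hX : P.inflation^[N] X = X)
    {T : Fin n → Set (EuclideanSpace ℝ (Fin d))} (hT : P.IsCompactMultiTileSolution T)
    (i : Fin n) : 0 < volume (T i) := by
  obtain ⟨j, x₀, hx₀⟩ := hXne
  refine hT.volume_pos_of_volume_pos hP (j := j) ?_ i
  obtain ⟨r, hr, M, -, hM⟩ := hXd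
  have hdet : 0 < |P.mat.det| := abs_pos.2 hA.isUnit_det.ne_zero
  obtain ⟨c, hc, m₀, hcm⟩ := hP.exists_mul_pow_le hn (hperron ▸ hdet)
  rw [hperron] at hcm
  obtain ⟨R, hR, hTR⟩ := exists_bound_of_isCompact hT.1
  set V := volume (Metric.ball (0 : EuclideanSpace ℝ (Fin d)) r)
  have key : ∀ ε : ℝ, 0 < ε →
      ENNReal.ofReal c * V ≤ M * volume (Metric.cthickening ε (T j)) := by
    intro ε hε
    obtain ⟨m₁, hm₁⟩ := hA.exists_norm_le (ε / (r + R)) (by positivity)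
    obtain ⟨m, hmN, hm0, hm1⟩ : ∃ m, P.inflation^[m] X = X ∧ m₀ ≤ m ∧ m₁ ≤ m := by
      refine ⟨N * (m₀ + m₁), ?_, ?_, ?_⟩
      · rw [Function.iterate_mul]
        exact Function.iterate_fixed hX _
      · exact (Nat.le_add_right _ _).trans (Nat.le_mul_of_pos_left _ hN)
      · exact (Nat.le_add_left _ _).trans (Nat.le_mul_of_pos_left _ hN)
    set D := P.iterDigits m j j with hDdef
    have h1 : (D.card : ℝ≥0∞) * V ≤ M * volume (⋃ e ∈ {e | e ∈ D}, Metric.ball e r) :=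
      card_mul_volume_ball_le fun y _ => card_filter_iterDigits_le hA.isUnit_det hM hmN hx₀ j y
    have h2 : (⋃ e ∈ {e | e ∈ D}, Metric.ball e r) ⊆
        Matrix.toEuclideanLin (P.mat ^ m) '' Metric.cthickening ε (T j) := by
      intro y hy
      obtain ⟨e, he, hye⟩ := Set.mem_iUnion₂.1 hy
      obtain ⟨t, ht⟩ := hT.forall_nonempty hP j
      obtain ⟨x, hx, hxt⟩ := hT.mem_image_iterate_iff.2 ⟨j, t, ht, e, he, rfl⟩
      refine ⟨Matrix.toEuclideanLin (P.mat⁻¹ ^ m) y, ?_,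
        Matrix.toEuclideanLin_pow_inv_pow hA.isUnit_det m y⟩
      refine Metric.mem_cthickening_of_dist_le _ x _ _ hx ?_
      rw [← Matrix.toEuclideanLin_inv_pow_pow hA.isUnit_det m x, hxt, dist_eq_norm, ← map_sub]
      refine (hm₁ m hm1 _).trans ?_
      have : ‖y - (t + e)‖ ≤ r + R := by
        rw [show y - (t + e) = (y - e) - t by abel]
        refine (norm_sub_le _ _).trans (add_le_add ?_ (hTR j t ht))
        rw [← dist_eq_norm]
        exact (Metric.mem_ball.1 hye).le
      calc ε / (r + R) * ‖y - (t + e)‖ ≤ ε / (r + R) * (r + R) := by gcongr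
        _ = ε := by field_simp
    have h3 : ENNReal.ofReal (c * |P.mat.det| ^ m) ≤ D.card := by
      rw [← ENNReal.ofReal_natCast, hDdef, card_iterDigits]
      exact ENNReal.ofReal_le_ofReal (hcm m hm0 j j)
    have h4 := measure_mono (μ := volume) h2
    rw [Matrix.volume_image_toEuclideanLin, Matrix.det_pow, abs_pow] at h4
    have h5 : ENNReal.ofReal (|P.mat.det| ^ m) ≠ 0 := by
      rw [Ne, ENNReal.ofReal_eq_zero, not_le]
      exact pow_pos hdet m
    rw [← ENNReal.mul_le_mul_iff_right h5 ENNReal.ofReal_ne_top]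
    calc ENNReal.ofReal (|P.mat.det| ^ m) * (ENNReal.ofReal c * V)
        = ENNReal.ofReal (c * |P.mat.det| ^ m) * V := by
          rw [ENNReal.ofReal_mul hc.le]
          ring
      _ ≤ D.card * V := by gcongr
      _ ≤ M * volume (⋃ e ∈ {e | e ∈ D}, Metric.ball e r) := h1
      _ ≤ M * (ENNReal.ofReal (|P.mat.det| ^ m) * volume (Metric.cthickening ε (T j))) := by gcongr
      _ = _ := by ring
  have hlim : Tendsto (fun ε => (M : ℝ≥0∞) * volume (Metric.cthickening ε (T j))) (𝓝[>] 0)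
      (𝓝 (M * volume (T j))) :=
    ENNReal.Tendsto.const_mul ((tendsto_measure_cthickening_of_isCompact (hT.1 j)).mono_left
      nhdsWithin_le_nhds) (Or.inr (ENNReal.natCast_ne_top M))
  have hle : ENNReal.ofReal c * V ≤ M * volume (T j) :=
    ge_of_tendsto hlim (eventually_mem_nhdsWithin.mono fun ε hε => key ε hε)
  have hpos : 0 < ENNReal.ofReal c * V :=
    ENNReal.mul_pos (by simpa using hc) (Metric.measure_ball_pos _ _ hr).ne'
  exact (CanonicallyOrderedAdd.mul_pos.1 (hpos.trans_le hle)).2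

/-! ### Tiles of positive measure do not overlap -/

variable {T : Fin n → Set (EuclideanSpace ℝ (Fin d))}

/-- The volumes of the tiles form a left Perron eigenvector of the subdivision matrix. -/
theorem IsCompactMultiTileSolution.vecMul_volume (hn : 0 < n)
    (hP : P.subdivisionMatrix.IsPrimitive)
    (hperron : P.subdivisionMatrix.perronEigenvalue = |P.mat.det|)
    (hT : P.IsCompactMultiTileSolution T) (hpos : ∀ i, 0 < volume (T i)) (i : Fin n) :
    ((fun j => (volume (T j)).toReal) ᵥ* P.subdivisionMatrix) i =
      |P.mat.det| * (volume (T i)).toReal := by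
  have hfin : ∀ i, volume (T i) ≠ ⊤ := fun i => (hT.1 i).measure_lt_top.ne
  have hmeas : ∀ i, MeasurableSet (T i) := fun i => (hT.1 i).measurableSet
  rw [← hperron]
  refine hP.vecMul_eq_of_le hn (fun j => ENNReal.toReal_pos (hpos j).ne' (hfin j)) (fun i => ?_) i
  have h1 : ENNReal.ofReal |P.mat.det| * volume (T i) ≤
      ∑ j, (P.digits j i).card * volume (T j) := by
    rw [← Matrix.volume_image_toEuclideanLin, ← lintegral_coverCount hmeas (fun j => P.digits j i),
      ← lintegral_indicator_one
        ((hT.1 i).image (Matrix.continuous_toEuclideanLin P.mat)).measurableSet]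
    refine lintegral_mono fun y => ?_
    refine Set.indicator_apply_le' (fun hy => ?_) fun _ => zero_le
    obtain ⟨j, t, ht, e, he, rfl⟩ := hT.mem_image_iff.1 hy
    exact one_le_coverCount (j := j) he ⟨t, ht, add_comm _ _⟩
  have h2 : ∑ j, ((P.digits j i).card : ℝ≥0∞) * volume (T j) ≠ ⊤ :=
    ENNReal.sum_ne_top.2 fun j _ => ENNReal.mul_ne_top (ENNReal.natCast_ne_top _) (hfin j)
  have h3 := ENNReal.toReal_mono h2 h1
  rw [ENNReal.toReal_mul, ENNReal.toReal_ofReal (abs_nonneg _), ENNReal.toReal_sum fun j _ =>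
    ENNReal.mul_ne_top (ENNReal.natCast_ne_top _) (hfin j)] at h3
  rw [hperron]
  refine h3.trans (le_of_eq (Finset.sum_congr rfl fun j _ => ?_))
  rw [ENNReal.toReal_mul, ENNReal.toReal_natCast, mul_comm]
  rfl

/-- The pieces of any subdivision `Aᵐ T_i = ⋃_j (T_j + D^m_ji)` are disjoint in measure, since their
volumes add up to that of `Aᵐ T_i`. -/
theorem IsCompactMultiTileSolution.coverCount_le_one (hn : 0 < n)
    (hP : P.subdivisionMatrix.IsPrimitive)
    (hperron : P.subdivisionMatrix.perronEigenvalue = |P.mat.det|)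
    (hT : P.IsCompactMultiTileSolution T) (hpos : ∀ i, 0 < volume (T i)) (m : ℕ) (i : Fin n) :
    ∀ᵐ y, coverCount T (fun j => P.iterDigits m j i) y ≤ 1 := by
  have hfin : ∀ i, volume (T i) ≠ ⊤ := fun i => (hT.1 i).measure_lt_top.ne
  have hmeas : ∀ i, MeasurableSet (T i) := fun i => (hT.1 i).measurableSet
  have hvec : ∀ m, ∀ i, ((fun j => (volume (T j)).toReal) ᵥ* P.subdivisionMatrix ^ m) i =
      |P.mat.det| ^ m * (volume (T i)).toReal := by
    intro m
    induction m with
    | zero => simp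
    | succ m ih =>
      intro i
      have h1 : (fun j => (volume (T j)).toReal) ᵥ* P.subdivisionMatrix ^ m =
          |P.mat.det| ^ m • fun j => (volume (T j)).toReal := funext ih
      rw [pow_succ P.subdivisionMatrix, ← Matrix.vecMul_vecMul, h1, Matrix.smul_vecMul,
        Pi.smul_apply, hT.vecMul_volume hn hP hperron hpos, smul_eq_mul]
      ring
  have hint : ∫⁻ y, coverCount T (fun j => P.iterDigits m j i) y =
      volume (Matrix.toEuclideanLin (P.mat ^ m) '' T i) := by
    rw [lintegral_coverCount hmeas, Matrix.volume_image_toEuclideanLin, Matrix.det_pow, abs_pow,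
      ← ENNReal.ofReal_toReal (hfin i), ← ENNReal.ofReal_mul (by positivity), ← hvec m i]
    simp only [Matrix.vecMul, dotProduct]
    rw [ENNReal.ofReal_sum_of_nonneg fun j _ => mul_nonneg ENNReal.toReal_nonneg
      (Matrix.pow_apply_nonneg hP.nonneg m j i)]
    refine Finset.sum_congr rfl fun j _ => ?_
    rw [ENNReal.ofReal_mul ENNReal.toReal_nonneg, ENNReal.ofReal_toReal (hfin j),
      ← card_iterDigits, ENNReal.ofReal_natCast, mul_comm]
  have hcomp : IsCompact (Matrix.toEuclideanLin (P.mat ^ m) '' T i) :=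
    (hT.1 i).image (Matrix.continuous_toEuclideanLin _)
  have hle : (Matrix.toEuclideanLin (P.mat ^ m) '' T i).indicator
      (1 : EuclideanSpace ℝ (Fin d) → ℝ≥0∞) ≤ coverCount T (fun j => P.iterDigits m j i) := by
    intro y
    refine Set.indicator_apply_le' (fun hy => ?_) fun _ => zero_le
    obtain ⟨j, t, ht, e, he, rfl⟩ := hT.mem_image_iterate_iff.1 hy
    exact one_le_coverCount (D := fun j => P.iterDigits m j i) (j := j) he ⟨t, ht, add_comm _ _⟩
  have hae := ae_eq_of_ae_le_of_lintegral_le (μ := volume) (ae_of_all _ hle)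
    (by rw [lintegral_indicator_one hcomp.measurableSet]; exact hcomp.measure_lt_top.ne)
    (measurable_coverCount hmeas _).aemeasurable
    (by rw [hint, lintegral_indicator_one hcomp.measurableSet])
  filter_upwards [hae] with y hy
  rw [← hy]
  exact Set.indicator_apply_le' (fun _ => le_rfl) fun _ => zero_le

end InflationSystem

/-! ### Tiles of positive measure have interior points -/

section Averaging

variable {d : ℕ}

/-- An averaging form of the Lebesgue density theorem without any assumption on the shape of the
small sets: a compact set of positive measure contains a point `y` such that `y + G` is nearly full,
for every `G` in a small ball. -/
theorem exists_volume_vadd_diff_le {T : Set (EuclideanSpace ℝ (Fin d))} (hT : IsCompact T)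
    (hpos : 0 < volume T) {δ : ℝ≥0∞} (hδ : 0 < δ) :
    ∃ η : ℝ, 0 < η ∧ ∀ G : Set (EuclideanSpace ℝ (Fin d)), MeasurableSet G →
      (∀ z ∈ G, ‖z‖ ≤ η) → volume G ≠ 0 → volume G ≠ ⊤ →
      ∃ y ∈ T, volume ((y +ᵥ G) \ T) ≤ δ * volume G := by
  have hfin : volume T ≠ ⊤ := hT.measure_lt_top.ne
  have hlt : volume T < volume T + δ * volume T :=
    ENNReal.lt_add_right hfin (mul_ne_zero hδ.ne' hpos.ne')
  obtain ⟨η, hηH, hη⟩ := ((((tendsto_measure_cthickening_of_isCompact hT).mono_left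
    (nhdsWithin_le_nhds (s := Set.Ioi 0))).eventually_lt_const hlt).and
      eventually_mem_nhdsWithin).exists
  refine ⟨η, hη, fun G hG hGη hG0 hGtop => ?_⟩
  set H := Metric.cthickening η T with hH
  have hTH : T ⊆ H := Metric.self_subset_cthickening T
  have hHT : MeasurableSet (H \ T) :=
    Metric.isClosed_cthickening.measurableSet.diff hT.measurableSet
  have hvol : volume (H \ T) < δ * volume T := by
    rw [measure_sdiff hTH hT.measurableSet.nullMeasurableSet hfin]
    exact ENNReal.sub_lt_of_lt_add (measure_mono hTH) (by rwa [add_comm])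
  by_contra! hcon
  let W : Set (EuclideanSpace ℝ (Fin d) × EuclideanSpace ℝ (Fin d)) :=
    (T ×ˢ G) ∩ (fun p => p.1 + p.2) ⁻¹' (H \ T)
  have hW : MeasurableSet W :=
    (hT.measurableSet.prod hG).inter ((measurable_fst.add measurable_snd) hHT)
  -- The measure of `W` is computed by integrating first over `z ∈ G`, then over `y ∈ T`.
  have hlow : δ * volume G * volume T ≤ (volume.prod volume) W := by
    rw [Measure.prod_apply hW, ← lintegral_indicator_const hT.measurableSet]
    refine lintegral_mono fun y => Set.indicator_apply_le' (fun hy => ?_) fun _ => zero_le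
    refine (hcon y hy).le.trans ?_
    rw [← measure_preimage_add volume y]
    refine measure_mono ?_
    rintro z ⟨⟨z', hz', hzz⟩, hzT⟩
    have hz : z ∈ G := by
      have : z' = z := add_left_cancel (a := y) hzz
      rwa [← this]
    refine ⟨⟨hy, hz⟩, Metric.mem_cthickening_of_dist_le _ y _ _ hy ?_, hzT⟩
    simpa [dist_eq_norm] using hGη z hz
  have hup : (volume.prod volume) W ≤ volume (H \ T) * volume G := by
    rw [Measure.prod_apply_symm hW, ← lintegral_indicator_const hG]
    refine lintegral_mono fun z => ?_
    by_cases hz : z ∈ G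
    · rw [Set.indicator_of_mem hz, ← measure_preimage_add_right volume z (H \ T)]
      exact measure_mono fun y hy => hy.2
    · rw [Set.indicator_of_notMem hz]
      refine (measure_mono_null (t := ∅) (fun y hy => hz hy.1.2) measure_empty).le
  have := hlow.trans hup
  rw [mul_right_comm, ENNReal.mul_le_mul_iff_left hG0 hGtop] at this
  exact absurd hvol (not_lt.2 this)

theorem exists_nonempty_interior_of_subset_iUnion {X ι : Type*} [TopologicalSpace X] [Finite ι]
    {U : Set X} (hU : IsOpen U) (hne : U.Nonempty) {F : ι → Set X} (hF : ∀ k, IsClosed (F k))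
    (h : U ⊆ ⋃ k, F k) : ∃ k, (interior (F k)).Nonempty := by
  by_contra! hcon
  have : Fintype ι := Fintype.ofFinite ι
  have hs : ∀ s : Finset ι, interior (⋃ k ∈ s, F k) = ∅ := by
    classical
    intro s
    induction s using Finset.induction with
    | empty => simp
    | insert a s _ ih =>
      rw [Finset.set_biUnion_insert, interior_union_isClosed_of_interior_empty (hF a) ih, hcon]
  have h2 : U ⊆ interior (⋃ k ∈ (Finset.univ : Finset ι), F k) :=
    interior_maximal (by simpa using h) hU
  rw [hs] at h2
  obtain ⟨x, hx⟩ := hne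
  exact h2 hx

/-- A multiset with at most `K` elements is listed by a `K`-tuple padded with a default value. -/
theorem Multiset.exists_fin_of_card_le {α : Type*} (W : Multiset α) {K : ℕ} (hK : W.card ≤ K)
    (a₀ : α) : ∃ w : Fin K → α, (∀ a ∈ W, ∃ k, w k = a) ∧ ∀ k, w k ∈ W ∨ w k = a₀ := by
  refine ⟨fun k => W.toList.getD k a₀, fun a ha => ?_, fun k => ?_⟩
  · obtain ⟨k, hk, hka⟩ := List.mem_iff_getElem.1 (Multiset.mem_toList.2 ha)
    refine ⟨⟨k, hk.trans_le (by simpa using hK)⟩, ?_⟩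
    simp only
    rw [List.getD_eq_getElem _ _ hk, hka]
  · by_cases hk : (k : ℕ) < W.toList.length
    · left
      simp only
      rw [List.getD_eq_getElem _ _ hk, ← Multiset.mem_toList]
      exact List.getElem_mem hk
    · right
      exact List.getD_eq_default _ _ (not_lt.1 hk)

/-- If the unit ball can be filled up to arbitrarily small measure by a bounded number of translates
of compact sets `T_j` with translation vectors in a bounded set, then a limiting arrangement fills
it completely and some `T_j` has interior points. -/
theorem exists_nonempty_interior_of_forall_volume_diff_le {n K : ℕ}
    {T : Fin n → Set (EuclideanSpace ℝ (Fin d))} (hT : ∀ j, IsCompact (T j)) {R : ℝ}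
    (h : ∀ δ : ℝ≥0∞, 0 < δ → ∃ w : Fin K → Fin n × EuclideanSpace ℝ (Fin d),
      (∀ k, ‖(w k).2‖ ≤ R) ∧
      volume (Metric.ball (0 : EuclideanSpace ℝ (Fin d)) 1 \ ⋃ k, ((w k).2 +ᵥ T (w k).1)) ≤ δ) :
    ∃ j, (interior (T j)).Nonempty := by
  have hδ : ∀ l : ℕ, (0 : ℝ≥0∞) < ((l : ℝ≥0∞) + 1)⁻¹ := fun l =>
    ENNReal.inv_pos.2 (by finiteness)
  choose w hwR hwv using fun l : ℕ => h _ (hδ l)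
  have hcomp : IsCompact (Set.univ.pi fun _ : Fin K =>
      (Set.univ : Set (Fin n)) ×ˢ Metric.closedBall (0 : EuclideanSpace ℝ (Fin d)) R) :=
    isCompact_univ_pi fun _ => isCompact_univ.prod (isCompact_closedBall _ _)
  obtain ⟨u, -, φ, hφ, hu⟩ := hcomp.tendsto_subseq (x := w) fun l k _ =>
    ⟨Set.mem_univ _, by simpa using hwR l k⟩
  have hclosed : ∀ k, IsClosed ((u k).2 +ᵥ T (u k).1) := fun k =>
    ((hT _).vadd (u k).2).isClosed
  have hsub : Metric.ball (0 : EuclideanSpace ℝ (Fin d)) 1 ⊆ ⋃ k, ((u k).2 +ᵥ T (u k).1) := by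
    by_contra hnot
    obtain ⟨y, hy, hyU⟩ := Set.not_subset.1 hnot
    have hopen : IsOpen (Metric.ball (0 : EuclideanSpace ℝ (Fin d)) 1 \
        ⋃ k, ((u k).2 +ᵥ T (u k).1)) := Metric.isOpen_ball.sdiff (isClosed_iUnion_of_finite hclosed)
    obtain ⟨ρ, hρ, hρU⟩ := Metric.isOpen_iff.1 hopen y ⟨hy, hyU⟩
    have hev : ∀ᶠ l in atTop, ∀ k, (w (φ l) k).1 = (u k).1 ∧
        dist (w (φ l) k).2 (u k).2 < ρ / 2 := by
      rw [eventually_all]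
      intro k
      have hk := (tendsto_pi_nhds.1 hu) k
      have h1 := (continuous_fst.tendsto _).comp hk
      have h2 := (continuous_snd.tendsto _).comp hk
      exact (h1.eventually (IsOpen.mem_nhds (isOpen_discrete {(u k).1}) rfl)).and
        (Metric.tendsto_nhds.1 h2 _ (half_pos hρ))
    have hball : 0 < volume (Metric.ball y (ρ / 2)) := Metric.measure_ball_pos _ _ (half_pos hρ)
    have hsmall : Tendsto (fun l : ℕ => ((φ l : ℝ≥0∞) + 1)⁻¹) atTop (𝓝 0) := by
      have h1 : Tendsto (fun l : ℕ => ((l : ℝ≥0∞) + 1)) atTop (𝓝 ⊤) := by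
        refine tendsto_nhds_top_mono ENNReal.tendsto_nat_nhds_top ?_
        exact Eventually.of_forall fun l => le_self_add
      have h2 := (tendsto_inv_iff.2 h1).comp hφ.tendsto_atTop
      simpa [Function.comp_def] using h2
    obtain ⟨l, hl1, hl2⟩ := (hev.and (hsmall.eventually_lt_const hball)).exists
    refine absurd ((measure_mono ?_).trans (hwv (φ l))) (not_le.2 hl2)
    intro z hz
    have hz2 : z ∈ Metric.ball y ρ := Metric.ball_subset_ball (by linarith) hz
    refine ⟨(hρU hz2).1, fun hzU => ?_⟩
    obtain ⟨k, t, ht, htz⟩ := Set.mem_iUnion.1 hzU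
    obtain ⟨hk1, hk2⟩ := hl1 k
    have hz3 : (u k).2 + t ∈ Metric.ball y ρ := by
      rw [Metric.mem_ball] at hz ⊢
      have h3 : dist ((u k).2 + t) z < ρ / 2 := by
        rw [← htz]
        change dist ((u k).2 + t) ((w (φ l) k).2 + t) < _
        rwa [dist_add_right, dist_comm]
      linarith [dist_triangle ((u k).2 + t) z y]
    refine (hρU hz3).2 (Set.mem_iUnion.2 ⟨k, t, ?_, rfl⟩)
    rwa [← hk1]
  obtain ⟨k, hk⟩ := exists_nonempty_interior_of_subset_iUnion Metric.isOpen_ball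
    ⟨0, Metric.mem_ball_self one_pos⟩ hclosed hsub
  refine ⟨(u k).1, ?_⟩
  rwa [interior_vadd, Set.vadd_set_nonempty] at hk

end Averaging

namespace InflationSystem

variable {d n : ℕ} {P : InflationSystem d n} {T : Fin n → Set (EuclideanSpace ℝ (Fin d))}

/-- A unit ball well inside an inflated tile is almost filled by that tile. -/
theorem exists_volume_ball_diff_image_le (hA : P.mat.HasContractingInverse) {i : Fin n}
    (hT : IsCompact (T i)) (hpos : 0 < volume (T i)) {δ : ℝ≥0∞} (hδ : 0 < δ) :
    ∃ m c, volume (Metric.ball c 1 \ Matrix.toEuclideanLin (P.mat ^ m) '' T i) ≤ δ := by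
  set B := Metric.ball (0 : EuclideanSpace ℝ (Fin d)) 1 with hB
  have hB0 : volume B ≠ 0 := (Metric.measure_ball_pos _ _ one_pos).ne'
  have hBtop : volume B ≠ ⊤ := measure_ball_lt_top.ne
  obtain ⟨η, hη, hG⟩ := exists_volume_vadd_diff_le hT hpos (δ := δ / volume B)
    (ENNReal.div_pos hδ.ne' hBtop)
  obtain ⟨m, hm⟩ := hA.exists_norm_le η hη
  have hdet : 0 < |P.mat.det| := abs_pos.2 hA.isUnit_det.ne_zero
  set f := Matrix.toEuclideanLin (P.mat ^ m) with hf
  set g := Matrix.toEuclideanLin (P.mat⁻¹ ^ m) with hg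
  have hfg : ∀ x, f (g x) = x := Matrix.toEuclideanLin_pow_inv_pow hA.isUnit_det m
  have hgf : ∀ x, g (f x) = x := Matrix.toEuclideanLin_inv_pow_pow hA.isUnit_det m
  have hfinj : Function.Injective f := Function.LeftInverse.injective hgf
  have hGimg : g '' B = f ⁻¹' B := by
    ext x
    constructor
    · rintro ⟨b, hb, rfl⟩
      rwa [Set.mem_preimage, hfg]
    · intro hx
      exact ⟨f x, hx, hgf x⟩
  have hfG : f '' (g '' B) = B := by
    rw [← Set.image_comp]
    exact (Set.image_congr fun x _ => hfg x).trans (Set.image_id B)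
  have hvol : ∀ s, volume (f '' s) = ENNReal.ofReal (|P.mat.det| ^ m) * volume s := by
    intro s
    rw [hf, Matrix.volume_image_toEuclideanLin, Matrix.det_pow, abs_pow]
  have hBG : volume B = ENNReal.ofReal (|P.mat.det| ^ m) * volume (g '' B) := by
    rw [← hvol, hfG]
  have hGm : MeasurableSet (g '' B) := by
    rw [hGimg]
    exact (Metric.isOpen_ball.preimage (Matrix.continuous_toEuclideanLin _)).measurableSet
  have hG1 : ∀ z ∈ g '' B, ‖z‖ ≤ η := by
    rintro _ ⟨b, hb, rfl⟩
    refine (hm m le_rfl b).trans (mul_le_of_le_one_right hη.le ?_)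
    simpa using (Metric.mem_ball.1 hb).le
  have hG2 : volume (g '' B) ≠ 0 := by
    intro h0
    rw [h0, mul_zero] at hBG
    exact hB0 hBG
  have hG3 : volume (g '' B) ≠ ⊤ := by
    intro htop
    rw [htop, ENNReal.mul_top] at hBG
    · exact hBtop hBG
    · rw [Ne, ENNReal.ofReal_eq_zero, not_le]
      exact pow_pos hdet m
  obtain ⟨y, -, hy⟩ := hG (g '' B) hGm hG1 hG2 hG3
  refine ⟨m, f y, ?_⟩
  have himg : Metric.ball (f y) 1 \ f '' T i = f '' ((y +ᵥ g '' B) \ T i) := by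
    rw [Set.image_sdiff hfinj]
    congr 1
    have hshift : ∀ G : Set (EuclideanSpace ℝ (Fin d)), f '' (y +ᵥ G) = f y +ᵥ f '' G := by
      intro G
      rw [← Set.image_vadd, ← Set.image_vadd, Set.image_image, Set.image_image]
      exact Set.image_congr fun x _ => map_add f y x
    rw [hshift, hfG, hB, Metric.vadd_ball, vadd_eq_add, add_zero]
  rw [himg, hvol]
  calc ENNReal.ofReal (|P.mat.det| ^ m) * volume ((y +ᵥ g '' B) \ T i)
      ≤ ENNReal.ofReal (|P.mat.det| ^ m) * (δ / volume B * volume (g '' B)) := by gcongr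
    _ = δ / volume B * volume B := by
        rw [mul_left_comm, ← hBG]
    _ = δ := ENNReal.div_mul_cancel hB0 hBtop

theorem _root_.coverCount_filter_le {D : Fin n → Multiset (EuclideanSpace ℝ (Fin d))}
    (p : EuclideanSpace ℝ (Fin d) → Prop) [DecidablePred p] (y : EuclideanSpace ℝ (Fin d)) :
    coverCount T (fun j => (D j).filter p) y ≤ coverCount T D y := by
  refine Finset.sum_le_sum fun j _ => ?_
  conv_rhs => rw [← Multiset.filter_add_not p (D j), Multiset.map_add, Multiset.sum_add]
  exact le_self_add

/-- The pieces of inflated tiles meeting an almost filled unit ball are bounded in number, as they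
do not overlap, and a limit of such arrangements fills the ball. -/
theorem IsCompactMultiTileSolution.exists_nonempty_interior (hn : 0 < n)
    (hA : P.mat.HasContractingInverse) (hP : P.subdivisionMatrix.IsPrimitive)
    (hperron : P.subdivisionMatrix.perronEigenvalue = |P.mat.det|)
    (hT : P.IsCompactMultiTileSolution T) (hpos : ∀ i, 0 < volume (T i)) :
    ∃ j, (interior (T j)).Nonempty := by
  classical
  have : Nonempty (Fin n) := ⟨⟨0, hn⟩⟩
  let i : Fin n := ⟨0, hn⟩
  have hfin : ∀ i, volume (T i) ≠ ⊤ := fun i => (hT.1 i).measure_lt_top.ne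
  have hmeas : ∀ i, MeasurableSet (T i) := fun i => (hT.1 i).measurableSet
  obtain ⟨R, hR, hTR⟩ := exists_bound_of_isCompact hT.1
  obtain ⟨j₀, hj₀⟩ := Finite.exists_min fun j => volume (T j)
  set V := volume (Metric.closedBall (0 : EuclideanSpace ℝ (Fin d)) (R + 1 + R)) with hV
  have hVtop : V ≠ ⊤ := measure_closedBall_lt_top.ne
  -- A volume count bounds the number of non-overlapping tiles meeting a unit ball.
  obtain ⟨K, hK⟩ : ∃ K : ℕ, V / volume (T j₀) < K :=
    ENNReal.exists_nat_gt (ENNReal.div_lt_top hVtop (hpos j₀).ne').ne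
  refine exists_nonempty_interior_of_forall_volume_diff_le hT.1 (K := K) (R := R + 1)
    fun δ hδ => ?_
  obtain ⟨m, c, hmc⟩ := exists_volume_ball_diff_image_le hA (hT.1 i) (hpos i) hδ
  let D : Fin n → Multiset (EuclideanSpace ℝ (Fin d)) := fun j =>
    (P.iterDigits m j i).filter fun e => ‖e - c‖ ≤ R + 1
  let W : Multiset (Fin n × EuclideanSpace ℝ (Fin d)) := ∑ j, (D j).map fun e => (j, e - c)
  have hmemW : ∀ j x, (j, x) ∈ W ↔ x + c ∈ D j := by
    intro j x
    simp only [W, Multiset.mem_sum, Finset.mem_univ, true_and, Multiset.mem_map, Prod.mk.injEq]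
    constructor
    · rintro ⟨l, e, he, rfl, rfl⟩
      rwa [sub_add_cancel]
    · intro h
      exact ⟨j, x + c, h, rfl, add_sub_cancel_right _ _⟩
  have hWcard : W.card ≤ K := by
    have hc1 : (W.card : ℝ≥0∞) * volume (T j₀) ≤ V := by
      calc (W.card : ℝ≥0∞) * volume (T j₀) = ∑ j, (D j).card * volume (T j₀) := by
            simp only [W, Multiset.card_sum, Multiset.card_map, Nat.cast_sum, Finset.sum_mul]
        _ ≤ ∑ j, (D j).card * volume (T j) :=
            Finset.sum_le_sum fun j _ => mul_le_mul_right (hj₀ j) _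
        _ = ∫⁻ y, coverCount T D y := (lintegral_coverCount hmeas D).symm
        _ ≤ ∫⁻ y, (Metric.closedBall c (R + 1 + R)).indicator 1 y := by
            refine lintegral_mono_ae ?_
            filter_upwards [hT.coverCount_le_one hn hP hperron hpos m i] with y hy
            by_cases hyc : y ∈ Metric.closedBall c (R + 1 + R)
            · rw [Set.indicator_of_mem hyc]
              exact (coverCount_filter_le _ y).trans hy
            · rw [Set.indicator_of_notMem hyc]
              refine le_of_eq (Finset.sum_eq_zero fun j _ => Multiset.sum_eq_zero ?_)
              intro x hx
              obtain ⟨e, he, rfl⟩ := Multiset.mem_map.1 hx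
              refine Set.indicator_of_notMem ?_ _
              rintro ⟨t, ht, rfl⟩
              refine hyc ?_
              rw [Metric.mem_closedBall, dist_eq_norm]
              change ‖e + t - c‖ ≤ _
              rw [add_sub_right_comm]
              exact (norm_add_le _ _).trans (add_le_add (Multiset.mem_filter.1 he).2 (hTR j t ht))
        _ = V := by
            rw [lintegral_indicator_one measurableSet_closedBall, hV,
              Measure.addHaar_closedBall_center]
    have hc2 : (W.card : ℝ≥0∞) ≤ V / volume (T j₀) :=
      (ENNReal.le_div_iff_mul_le (Or.inl (hpos j₀).ne') (Or.inl (hfin j₀))).2 hc1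
    exact_mod_cast (hc2.trans_lt hK).le
  obtain ⟨w, hwW, hw⟩ := W.exists_fin_of_card_le hWcard (i, 0)
  refine ⟨w, fun k => ?_, ?_⟩
  · rcases hw k with h | h
    · have h2 : ((w k).1, (w k).2) ∈ W := h
      rw [hmemW] at h2
      simpa using (Multiset.mem_filter.1 h2).2
    · rw [h]
      simpa using by linarith
  · refine le_trans ?_ hmc
    rw [← measure_preimage_add_right volume c (Metric.ball c 1 \ _)]
    refine measure_mono ?_
    rintro y ⟨hy, hyU⟩
    refine ⟨by simpa using hy, fun hyT => hyU ?_⟩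
    obtain ⟨j, t, ht, e, he, hte⟩ := hT.mem_image_iterate_iff.1 hyT
    have hec : e - c = y - t := by
      rw [sub_eq_sub_iff_add_eq_add, add_comm]
      exact hte
    have hD : (e - c) + c ∈ D j := by
      rw [sub_add_cancel]
      refine Multiset.mem_filter.2 ⟨he, ?_⟩
      rw [hec, add_comm R]
      exact (norm_sub_le _ _).trans (add_le_add (by simpa using (Metric.mem_ball.1 hy).le)
        (hTR j t ht))
    obtain ⟨k, hk⟩ := hwW _ ((hmemW j _).2 hD)
    refine Set.mem_iUnion.2 ⟨k, t, ?_, ?_⟩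
    · rwa [hk]
    · rw [hk]
      change (e - c) + t = y
      rw [hec, sub_add_cancel]

theorem IsCompactMultiTileSolution.forall_nonempty_interior (hn : 0 < n)
    (hA : P.mat.HasContractingInverse) (hP : P.subdivisionMatrix.IsPrimitive)
    (hperron : P.subdivisionMatrix.perronEigenvalue = |P.mat.det|)
    (hT : P.IsCompactMultiTileSolution T) (hpos : ∀ i, 0 < volume (T i)) (i : Fin n) :
    (interior (T i)).Nonempty := by
  obtain ⟨j, x, hx⟩ := hT.exists_nonempty_interior hn hA hP hperron hpos
  obtain ⟨k, -, hk⟩ := exists_forall_iterDigits_nonempty hP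
  obtain ⟨e, he⟩ := hk j i
  have hcont : Continuous fun y => Matrix.toEuclideanLin (P.mat ^ k) y - e :=
    (Matrix.continuous_toEuclideanLin _).sub continuous_const
  refine ⟨Matrix.toEuclideanLin (P.mat⁻¹ ^ k) (x + e), ?_⟩
  refine interior_maximal (t := (fun y => Matrix.toEuclideanLin (P.mat ^ k) y - e) ⁻¹'
    interior (T j)) ?_ (isOpen_interior.preimage hcont) ?_
  · intro y hy
    obtain ⟨y', hy', h⟩ := hT.mem_image_iterate_iff.2
      ⟨j, _, interior_subset hy, e, he, rfl⟩
    rw [sub_add_cancel] at h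
    have h2 := congrArg (Matrix.toEuclideanLin (P.mat⁻¹ ^ k)) h
    rw [Matrix.toEuclideanLin_inv_pow_pow hA.isUnit_det,
      Matrix.toEuclideanLin_inv_pow_pow hA.isUnit_det] at h2
    rwa [← h2]
  · rw [Set.mem_preimage, Matrix.toEuclideanLin_pow_inv_pow hA.isUnit_det, add_sub_cancel_right]
    exact hx

/-! ### The self-replicating multi-tiling -/

theorem add_mem_iterDigits {k m : ℕ} {i l j : Fin n} {a b : EuclideanSpace ℝ (Fin d)}
    (ha : a ∈ P.iterDigits k i l) (hb : b ∈ P.iterDigits m l j) :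
    a + Matrix.toEuclideanLin (P.mat ^ k) b ∈ P.iterDigits (k + m) i j := by
  induction m generalizing j b with
  | zero =>
    by_cases h : l = j
    · subst h
      have hb0 : b = 0 := by simpa [iterDigits] using hb
      simpa [hb0] using ha
    · simp [iterDigits, h] at hb
  | succ m ih =>
    obtain ⟨l', b', hb', c, hc, rfl⟩ := mem_iterDigits_succ.1 hb
    refine mem_iterDigits_succ.2 ⟨l', _, ih hb', c, hc, ?_⟩
    rw [Nat.add_eq, map_add, pow_add, Matrix.toEuclideanLin_mul_apply, add_assoc]

/-- Some iterated subdivision of a tile with interior points has a piece of the same type inside the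
interior of the tile. -/
theorem IsCompactMultiTileSolution.exists_piece_subset_interior
    (hA : P.mat.HasContractingInverse) (hP : P.subdivisionMatrix.IsPrimitive)
    (hT : P.IsCompactMultiTileSolution T) {i : Fin n} (hint : (interior (T i)).Nonempty) :
    ∃ m > 0, ∃ e ∈ P.iterDigits m i i, ∀ t ∈ T i,
      Matrix.toEuclideanLin (P.mat⁻¹ ^ m) (t + e) ∈ interior (T i) := by
  obtain ⟨y, hy⟩ := hint
  obtain ⟨ε, hε, hball⟩ := Metric.isOpen_iff.1 isOpen_interior y hy
  obtain ⟨R, hR, hTR⟩ := exists_bound_of_isCompact hT.1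
  obtain ⟨k, hk0, hk⟩ := exists_forall_iterDigits_nonempty hP
  obtain ⟨m, hm⟩ := hA.exists_norm_le (ε / (4 * R)) (by positivity)
  obtain ⟨j, s, hs, a, ha, hsa⟩ :=
    hT.mem_image_iterate_iff (m := m).1 ⟨y, interior_subset hy, rfl⟩
  obtain ⟨b, hb⟩ := hk i j
  refine ⟨k + m, by omega, _, add_mem_iterDigits hb ha, fun t ht => hball ?_⟩
  obtain ⟨s', hs', hst⟩ := hT.mem_image_iterate_iff.2 ⟨i, t, ht, b, hb, rfl⟩
  have h1 : Matrix.toEuclideanLin (P.mat⁻¹ ^ (k + m))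
      (t + (b + Matrix.toEuclideanLin (P.mat ^ k) a)) =
      Matrix.toEuclideanLin (P.mat⁻¹ ^ m) (s' + a) := by
    rw [← add_assoc, ← hst, ← map_add, add_comm k, pow_add, Matrix.toEuclideanLin_mul_apply,
      Matrix.toEuclideanLin_inv_pow_pow hA.isUnit_det]
  have h2 : y = Matrix.toEuclideanLin (P.mat⁻¹ ^ m) (s + a) := by
    rw [hsa, Matrix.toEuclideanLin_inv_pow_pow hA.isUnit_det]
  rw [h1, Metric.mem_ball, dist_eq_norm]
  rw [h2, ← map_sub, add_sub_add_right_eq_sub]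
  refine (hm m le_rfl _).trans_lt ?_
  calc ε / (4 * R) * ‖s' - s‖ ≤ ε / (4 * R) * (R + R) := by
        gcongr
        exact (norm_sub_le _ _).trans (add_le_add (hTR _ _ hs') (hTR _ _ hs))
    _ = ε / 2 := by field_simp; ring
    _ < ε := by linarith

theorem exists_fixed_point (hA : P.mat.HasContractingInverse) {m : ℕ} (hm : 0 < m)
    (e : EuclideanSpace ℝ (Fin d)) :
    ∃ y, Matrix.toEuclideanLin (P.mat⁻¹ ^ m) (y + e) = y := by
  set g := Matrix.toEuclideanLin (P.mat⁻¹ ^ m) with hg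
  obtain ⟨m₀, hm₀⟩ := (hA.pow hm).exists_norm_le (1 / 2) (by norm_num)
  have hinj : Function.Injective (1 - g : Module.End ℝ (EuclideanSpace ℝ (Fin d))) := by
    rw [injective_iff_map_eq_zero]
    intro x hx
    have hgx : g x = x := (sub_eq_zero.1 (by simpa using hx)).symm
    have hgk : ∀ k : ℕ, Matrix.toEuclideanLin ((P.mat⁻¹ ^ m) ^ k) x = x := by
      intro k
      induction k with
      | zero => rw [pow_zero, Matrix.toEuclideanLin_one_apply]
      | succ k ih => rw [pow_succ, Matrix.toEuclideanLin_mul_apply, ← hg, hgx, ih]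
    have h1 := hm₀ m₀ le_rfl x
    rw [← Matrix.inv_pow', hgk] at h1
    exact norm_eq_zero.1 (by linarith [norm_nonneg x])
  obtain ⟨y, hy⟩ := LinearMap.surjective_of_injective hinj (g e)
  refine ⟨y, ?_⟩
  rw [map_add, ← hy]
  simp

/-- The fixed point of the contraction onto a piece of type `i` is the limit of the orbit of any
point of `T_i`. -/
theorem IsCompactMultiTileSolution.fixed_point_mem (hA : P.mat.HasContractingInverse)
    (hP : P.subdivisionMatrix.IsPrimitive) (hT : P.IsCompactMultiTileSolution T) {i : Fin n}
    {m : ℕ} (hm : 0 < m) {e y : EuclideanSpace ℝ (Fin d)} (he : e ∈ P.iterDigits m i i)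
    (hy : Matrix.toEuclideanLin (P.mat⁻¹ ^ m) (y + e) = y) : y ∈ T i := by
  set g := Matrix.toEuclideanLin (P.mat⁻¹ ^ m) with hg
  obtain ⟨t, ht⟩ := hT.forall_nonempty hP i
  have hstep : ∀ k : ℕ, y + Matrix.toEuclideanLin ((P.mat⁻¹ ^ m) ^ k) (t - y) ∈ T i := by
    intro k
    induction k with
    | zero => simpa [Matrix.toEuclideanLin_one_apply] using ht
    | succ k ih =>
      obtain ⟨x, hx, hxe⟩ := hT.mem_image_iterate_iff.2 ⟨i, _, ih, e, he, rfl⟩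
      have h1 := congrArg g hxe
      rw [hg, Matrix.toEuclideanLin_inv_pow_pow hA.isUnit_det, ← hg, add_right_comm, map_add, hy,
        hg, ← Matrix.toEuclideanLin_mul_apply, ← pow_succ'] at h1
      rwa [← h1]
  rw [← (hT.1 i).isClosed.closure_eq, Metric.mem_closure_iff]
  intro ε hε
  obtain ⟨k, hk⟩ := (hA.pow hm).exists_norm_le (ε / (2 * (‖t - y‖ + 1))) (by positivity)
  refine ⟨_, hstep k, ?_⟩
  rw [dist_self_add_right, Matrix.inv_pow']
  refine (hk k le_rfl _).trans_lt ?_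
  calc ε / (2 * (‖t - y‖ + 1)) * ‖t - y‖ ≤ ε / (2 * (‖t - y‖ + 1)) * (‖t - y‖ + 1) := by
        gcongr
        linarith
    _ = ε / 2 := by field_simp
    _ < ε := by linarith

theorem inflation_mono {X Y : MultisetFamily d n} (h : X ≤ Y) : P.inflation X ≤ P.inflation Y :=
  fun _ _ => Finset.sum_le_sum fun j _ => Multiset.sum_map_le_sum_map _ _ fun _ _ => h j _

/-- The family with the single point `x₀`, of type `i` and of multiplicity one. -/
noncomputable def singleFamily (i : Fin n) (x₀ : EuclideanSpace ℝ (Fin d)) : MultisetFamily d n :=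
  open Classical in fun j x => if j = i ∧ x = x₀ then 1 else 0

/-- The `m`-th inflation of a point `x₀` of type `i` consists of the points `Aᵐ x₀ + e` of type `j`,
with `e ∈ D^m_ji`. -/
theorem iterate_inflation_singleFamily [DecidableEq (EuclideanSpace ℝ (Fin d))]
    (hA : IsUnit P.mat.det) (m : ℕ) (i j : Fin n) (x₀ x : EuclideanSpace ℝ (Fin d)) :
    P.inflation^[m] (singleFamily i x₀) j x =
      (P.iterDigits m j i).count (x - Matrix.toEuclideanLin (P.mat ^ m) x₀) := by
  rw [inflation_iterate hA]
  simp only [inflation, iterate]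
  rw [Finset.sum_eq_single i]
  · induction P.iterDigits m j i using Multiset.induction with
    | empty => simp
    | cons a D ih =>
      rw [Multiset.map_cons, Multiset.sum_cons, ih, Multiset.count_cons, add_comm]
      congr 1
      have hiff : Matrix.toEuclideanLin (P.mat ^ m)⁻¹ (x - a) = x₀ ↔
          x - Matrix.toEuclideanLin (P.mat ^ m) x₀ = a := by
        rw [← Matrix.inv_pow', sub_eq_iff_eq_add, ← sub_eq_iff_eq_add']
        constructor
        · intro h
          rw [← h, Matrix.toEuclideanLin_pow_inv_pow hA]
        · intro h
          rw [h, Matrix.toEuclideanLin_inv_pow_pow hA]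
      simp only [singleFamily, true_and, hiff]
  · intro l _ hl
    refine Multiset.sum_eq_zero fun y hy => ?_
    obtain ⟨a, -, rfl⟩ := Multiset.mem_map.1 hy
    simp [singleFamily, hl]
  · simp

/-- The union of the increasing sequence of families grown from one point `x₀` of type `i` by the
iterates of `ψ^m`. -/
noncomputable def grownFamily (P : InflationSystem d n) (m : ℕ) (i : Fin n)
    (x₀ : EuclideanSpace ℝ (Fin d)) : MultisetFamily d n :=
  open Classical in fun j x =>
    if ∃ k, P.inflation^[m * k] (singleFamily i x₀) j x ≠ 0 then 1 else 0

section Grown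

variable {m : ℕ} {i : Fin n} {x₀ : EuclideanSpace ℝ (Fin d)}

theorem monotone_iterate_inflation (h : singleFamily i x₀ ≤ P.inflation^[m] (singleFamily i x₀)) :
    Monotone fun k => P.inflation^[m * k] (singleFamily i x₀) := by
  simp only [Function.iterate_mul]
  have hmono : Monotone P.inflation^[m] :=
    Monotone.iterate (fun _ _ hXY => inflation_mono hXY) m
  exact hmono.monotone_iterate_of_le_map h

theorem eventually_iterate_inflation_eq
    (h : singleFamily i x₀ ≤ P.inflation^[m] (singleFamily i x₀))
    (h1 : ∀ k j x, P.inflation^[m * k] (singleFamily i x₀) j x ≤ 1) (j : Fin n)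
    (x : EuclideanSpace ℝ (Fin d)) :
    ∀ᶠ k in atTop, P.inflation^[m * k] (singleFamily i x₀) j x = P.grownFamily m i x₀ j x := by
  by_cases hx : ∃ k, P.inflation^[m * k] (singleFamily i x₀) j x ≠ 0
  · obtain ⟨k₀, hk₀⟩ := hx
    filter_upwards [eventually_ge_atTop k₀] with k hk
    have h2 : P.inflation^[m * k₀] (singleFamily i x₀) j x ≤
        P.inflation^[m * k] (singleFamily i x₀) j x := monotone_iterate_inflation h hk j x
    have h3 := h1 k j x
    rw [grownFamily, if_pos ⟨k₀, hk₀⟩]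
    omega
  · refine Eventually.of_forall fun k => ?_
    rw [grownFamily, if_neg hx]
    by_contra hk
    exact hx ⟨k, hk⟩

/-- Each value of `ψ^m` depends on finitely many values only, so `ψ^m` commutes with the increasing
limit. -/
theorem inflation_grownFamily (hA : IsUnit P.mat.det)
    (h : singleFamily i x₀ ≤ P.inflation^[m] (singleFamily i x₀))
    (h1 : ∀ k j x, P.inflation^[m * k] (singleFamily i x₀) j x ≤ 1) :
    P.inflation^[m] (P.grownFamily m i x₀) = P.grownFamily m i x₀ := by
  ext j x
  have hev : ∀ᶠ k in atTop, ∀ l, ∀ e ∈ {e | e ∈ (P.iterate m).digits j l},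
      P.inflation^[m * k] (singleFamily i x₀) l
        (Matrix.toEuclideanLin (P.iterate m).mat⁻¹ (x - e)) =
      P.grownFamily m i x₀ l (Matrix.toEuclideanLin (P.iterate m).mat⁻¹ (x - e)) := by
    rw [eventually_all]
    intro l
    rw [eventually_all_finite (finite_setOf_mem_digits _ j l)]
    exact fun e _ => eventually_iterate_inflation_eq h h1 _ _
  obtain ⟨k, hk1, hk2⟩ := (hev.and ((tendsto_add_atTop_nat 1).eventually
    (eventually_iterate_inflation_eq h h1 j x))).exists
  rw [← hk2, mul_add, mul_one, add_comm, Function.iterate_add_apply, inflation_iterate hA m,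
    inflation_iterate hA m]
  refine Finset.sum_congr rfl fun l _ => congrArg Multiset.sum (Multiset.map_congr rfl ?_)
  exact fun e he => (hk1 l e he).symm

/-- Any two points of the grown family already occur together in one of the increasing patches. -/
theorem exists_level (h : singleFamily i x₀ ≤ P.inflation^[m] (singleFamily i x₀))
    {p p' : Fin n × EuclideanSpace ℝ (Fin d)} (hp : P.grownFamily m i x₀ p.1 p.2 ≠ 0)
    (hp' : P.grownFamily m i x₀ p'.1 p'.2 ≠ 0) :
    ∃ k, P.inflation^[m * k] (singleFamily i x₀) p.1 p.2 ≠ 0 ∧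
      P.inflation^[m * k] (singleFamily i x₀) p'.1 p'.2 ≠ 0 := by
  have hex : ∀ q : Fin n × EuclideanSpace ℝ (Fin d), P.grownFamily m i x₀ q.1 q.2 ≠ 0 →
      ∃ k, P.inflation^[m * k] (singleFamily i x₀) q.1 q.2 ≠ 0 := by
    intro q hq
    by_contra hcon
    exact hq (if_neg hcon)
  obtain ⟨k, hk⟩ := hex p hp
  obtain ⟨k', hk'⟩ := hex p' hp'
  refine ⟨max k k', fun h0 => hk ?_, fun h0 => hk' ?_⟩
  · exact Nat.eq_zero_of_le_zero
      ((monotone_iterate_inflation h (le_max_left k k') p.1 p.2).trans h0.le)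
  · exact Nat.eq_zero_of_le_zero
      ((monotone_iterate_inflation h (le_max_right k k') p'.1 p'.2).trans h0.le)

end Grown

/-- The tiles cover the space, so points of some type occur near every place; `k` further inflations
produce points of every type from them. -/
theorem isRelativelyDense_of_covers (hA : P.mat.HasContractingInverse)
    (hP : P.subdivisionMatrix.IsPrimitive) (hT : ∀ i, IsCompact (T i)) {X : MultisetFamily d n}
    (hX : P.inflation X = X) (hcov : ∀ y, ∃ p : Fin n × EuclideanSpace ℝ (Fin d),
      X p.1 p.2 ≠ 0 ∧ y ∈ p.2 +ᵥ T p.1) (i : Fin n) : (X i).IsRelativelyDense := by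
  classical
  obtain ⟨R, hR, hTR⟩ := exists_bound_of_isCompact hT
  obtain ⟨k, -, hk⟩ := exists_forall_iterDigits_nonempty hP
  choose e he using fun j => hk i j
  obtain ⟨C, hC, hCA⟩ := Matrix.exists_norm_toEuclideanLin_le (P.mat ^ k)
  refine ⟨C * R + ∑ j, ‖e j‖ + 1, by positivity, fun c => ?_⟩
  obtain ⟨⟨j, x⟩, hx, t, ht, htx⟩ := hcov (Matrix.toEuclideanLin (P.mat⁻¹ ^ k) c)
  have htx' : x + t = Matrix.toEuclideanLin (P.mat⁻¹ ^ k) c := htx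
  refine ⟨e j + Matrix.toEuclideanLin (P.mat ^ k) x, ?_, ?_⟩
  · rw [Metric.mem_closedBall, dist_eq_norm,
      ← Matrix.toEuclideanLin_pow_inv_pow hA.isUnit_det k c, ← htx', add_sub_assoc, ← map_sub,
      sub_add_cancel_left]
    have h1 : ‖e j‖ ≤ ∑ j, ‖e j‖ :=
      Finset.single_le_sum (f := fun j => ‖e j‖) (fun _ _ => norm_nonneg _) (Finset.mem_univ j)
    have h2 : ‖Matrix.toEuclideanLin (P.mat ^ k) (-t)‖ ≤ C * R := by
      refine (hCA _).trans ?_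
      rw [norm_neg]
      gcongr
      exact hTR j t ht
    linarith [norm_add_le (e j) (Matrix.toEuclideanLin (P.mat ^ k) (-t))]
  · have h1 := count_iterDigits_le hA.isUnit_det (Function.iterate_fixed hX k) hx i (e j)
    exact (h1.trans_lt' (Multiset.count_pos.2 (he j))).ne'

/-- Two close translates of a tile with interior points overlap in a set of positive measure. -/
theorem isUniformlyDiscrete_of_ae_unique {X : MultisetFamily d n} (hX1 : ∀ j x, X j x ≤ 1)
    (hae : ∀ᵐ y ∂(volume : Measure (EuclideanSpace ℝ (Fin d))),
      ∀ p p' : Fin n × EuclideanSpace ℝ (Fin d), X p.1 p.2 ≠ 0 → y ∈ p.2 +ᵥ T p.1 →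
        X p'.1 p'.2 ≠ 0 → y ∈ p'.2 +ᵥ T p'.1 → p = p') {j : Fin n}
    (hint : (interior (T j)).Nonempty) : (X j).IsUniformlyDiscrete := by
  obtain ⟨z, hz⟩ := hint
  obtain ⟨ρ, hρ, hball⟩ := Metric.isOpen_iff.1 isOpen_interior z hz
  have hsep : ∀ x x', X j x ≠ 0 → X j x' ≠ 0 → dist x x' < ρ → x = x' := by
    intro x x' hx hx' hdist
    set U := Metric.ball (x + z) ρ ∩ Metric.ball (x' + z) ρ with hU
    have hUpos : 0 < volume U := by
      refine (Metric.isOpen_ball.inter Metric.isOpen_ball).measure_pos volume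
        ⟨x + z, Metric.mem_ball_self hρ, ?_⟩
      rwa [Metric.mem_ball, dist_add_right]
    obtain ⟨y, hyU, hy⟩ := ((frequently_ae_mem_iff.2 hUpos.ne').and_eventually hae).exists
    have hmem : ∀ a, y ∈ Metric.ball (a + z) ρ → y ∈ a +ᵥ T j := by
      intro a ha
      refine ⟨y - a, interior_subset (hball ?_), add_sub_cancel a y⟩
      rw [Metric.mem_ball, dist_eq_norm] at ha ⊢
      rwa [sub_sub]
    exact congrArg Prod.snd (hy (j, x) (j, x') hx (hmem x hyU.1) hx' (hmem x' hyU.2))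
  refine ⟨ρ / 2, half_pos hρ, fun c s hs => ?_⟩
  by_cases h0 : ∃ a ∈ s, X j a ≠ 0
  · obtain ⟨a, ha, hXa⟩ := h0
    rw [Finset.sum_eq_single_of_mem a ha]
    · exact hX1 j a
    · intro b hb hba
      by_contra hXb
      refine hba (hsep b a hXb hXa ?_)
      have h1 := Metric.mem_ball.1 (hs hb)
      have h2 := Metric.mem_ball'.1 (hs ha)
      linarith [dist_triangle b c a]
  · push Not at h0
    rw [Finset.sum_eq_zero h0]
    exact zero_le_one

/-- The tiles of positive measure admit a self-replicating multi-tiling. A piece of type `i` lies in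
the interior of the tile `T_i`; placing the tile so that the fixed point of the corresponding
contraction is the origin, its inflations increase and exhaust the space. -/
theorem IsCompactMultiTileSolution.exists_isSelfReplicatingMultiTilingFamily (hn : 0 < n)
    (hA : P.mat.HasContractingInverse) (hP : P.subdivisionMatrix.IsPrimitive)
    (hperron : P.subdivisionMatrix.perronEigenvalue = |P.mat.det|)
    (hT : P.IsCompactMultiTileSolution T) (hpos : ∀ i, 0 < volume (T i)) :
    ∃ m > 0, ∃ X : MultisetFamily d n,
      (P.iterate m).IsSelfReplicatingMultiTilingFamily X ∧ P.inflation^[m] X = X := by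
  classical
  have hdet := hA.isUnit_det
  have hint := hT.forall_nonempty_interior hn hA hP hperron hpos
  let i : Fin n := ⟨0, hn⟩
  obtain ⟨m, hm, e, he, heT⟩ := hT.exists_piece_subset_interior hA hP (hint i)
  obtain ⟨y₀, hy₀⟩ := exists_fixed_point hA hm e
  have hy₀T : y₀ ∈ interior (T i) := by
    rw [← hy₀]
    exact heT y₀ (hT.fixed_point_mem hA hP hm he hy₀)
  have hAy₀ : Matrix.toEuclideanLin (P.mat ^ m) y₀ = y₀ + e := by
    nth_rw 1 [← hy₀]
    rw [Matrix.toEuclideanLin_pow_inv_pow hdet]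
  let x₀ := -y₀
  -- `x₀ = Aᵐ x₀ + e` reappears in its own inflation, so the patches increase.
  have hgrow : singleFamily i x₀ ≤ P.inflation^[m] (singleFamily i x₀) := by
    intro j x
    rw [iterate_inflation_singleFamily hdet]
    by_cases h : j = i ∧ x = x₀
    · obtain ⟨rfl, rfl⟩ := h
      have hx : x₀ - Matrix.toEuclideanLin (P.mat ^ m) x₀ = e := by
        simp only [x₀, map_neg, hAy₀]
        abel
      rw [hx]
      exact (by simp [singleFamily] : singleFamily i x₀ i x₀ ≤ 1).trans (Multiset.count_pos.2 he)
    · rw [singleFamily, if_neg h]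
      exact zero_le
  have hcount := hT.coverCount_le_one hn hP hperron hpos
  have hone : ∀ k j x, P.inflation^[m * k] (singleFamily i x₀) j x ≤ 1 := by
    intro k j x
    rw [iterate_inflation_singleFamily hdet]
    set a := x - Matrix.toEuclideanLin (P.mat ^ (m * k)) x₀
    have hvol : volume (a +ᵥ T j) ≠ 0 := by
      rw [measure_vadd]
      exact (hpos j).ne'
    obtain ⟨y, hy1, hy2⟩ := ((frequently_ae_mem_iff.2 hvol).and_eventually
      (hcount (m * k) i)).exists
    exact count_le_one_of_coverCount_le_one (D := fun j => P.iterDigits (m * k) j i) hy2 hy1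
  set X := P.grownFamily m i x₀ with hXdef
  have hX1 : ∀ j x, X j x ≤ 1 := by
    intro j x
    rw [hXdef, grownFamily]
    split_ifs <;> simp
  have hfix : P.inflation^[m] X = X := inflation_grownFamily hdet hgrow hone
  have hfix' : (P.iterate m).inflation X = X := by rw [← inflation_iterate hdet, hfix]
  -- `A⁻ᵐᵏ y` is small, hence lies in the translated tile `T_i + x₀`, a neighbourhood of the origin.
  have hcov : ∀ y, ∃ p : Fin n × EuclideanSpace ℝ (Fin d), X p.1 p.2 ≠ 0 ∧ y ∈ p.2 +ᵥ T p.1 := by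
    intro y
    obtain ⟨ε, hε, hball⟩ := Metric.isOpen_iff.1 isOpen_interior y₀ hy₀T
    obtain ⟨k, hk⟩ := hA.exists_norm_le (ε / (2 * (‖y‖ + 1))) (by positivity)
    have hmk : k ≤ m * k := Nat.le_mul_of_pos_left k hm
    have hyT : y₀ + Matrix.toEuclideanLin (P.mat⁻¹ ^ (m * k)) y ∈ T i := by
      refine interior_subset (hball ?_)
      rw [Metric.mem_ball, dist_self_add_left]
      refine (hk _ hmk y).trans_lt ?_
      calc ε / (2 * (‖y‖ + 1)) * ‖y‖ ≤ ε / (2 * (‖y‖ + 1)) * (‖y‖ + 1) := by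
            gcongr
            linarith
        _ = ε / 2 := by field_simp
        _ < ε := by linarith
    obtain ⟨j, t, ht, b, hb, htb⟩ := hT.mem_image_iterate_iff (m := m * k).1 ⟨_, hyT, rfl⟩
    rw [map_add, Matrix.toEuclideanLin_pow_inv_pow hdet] at htb
    refine ⟨(j, b + Matrix.toEuclideanLin (P.mat ^ (m * k)) x₀), ?_, t, ht, ?_⟩
    · have hk0 : P.inflation^[m * k] (singleFamily i x₀) j
          (b + Matrix.toEuclideanLin (P.mat ^ (m * k)) x₀) ≠ 0 := by
        rw [iterate_inflation_singleFamily hdet, add_sub_cancel_right]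
        exact (Multiset.count_pos.2 hb).ne'
      change X j _ ≠ 0
      rw [hXdef, grownFamily, if_pos ⟨k, hk0⟩]
      exact one_ne_zero
    · change b + Matrix.toEuclideanLin (P.mat ^ (m * k)) x₀ + t = y
      rw [add_right_comm, add_comm b, htb]
      simp only [x₀, map_neg]
      abel
  have hae : ∀ᵐ y ∂(volume : Measure (EuclideanSpace ℝ (Fin d))),
      ∀ p p' : Fin n × EuclideanSpace ℝ (Fin d), X p.1 p.2 ≠ 0 → y ∈ p.2 +ᵥ T p.1 →
        X p'.1 p'.2 ≠ 0 → y ∈ p'.2 +ᵥ T p'.1 → p = p' := by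
    have hall : ∀ᵐ y ∂(volume : Measure (EuclideanSpace ℝ (Fin d))), ∀ k : ℕ,
        coverCount T (fun j => P.iterDigits (m * k) j i)
          (y - Matrix.toEuclideanLin (P.mat ^ (m * k)) x₀) ≤ 1 :=
      ae_all_iff.2 fun k => (measurePreserving_sub_right volume _).quasiMeasurePreserving.ae
        (hcount (m * k) i)
    filter_upwards [hall] with y hy p p' hp hyp hp' hyp'
    obtain ⟨k, hk, hk'⟩ := exists_level hgrow hp hp'
    rw [iterate_inflation_singleFamily hdet] at hk hk'
    set b := Matrix.toEuclideanLin (P.mat ^ (m * k)) x₀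
    have hsub : ∀ q : Fin n × EuclideanSpace ℝ (Fin d), y ∈ q.2 +ᵥ T q.1 →
        y - b ∈ (q.2 - b) +ᵥ T q.1 := by
      rintro q ⟨t, ht, rfl⟩
      exact ⟨t, ht, sub_add_eq_add_sub _ _ _⟩
    have h := eq_of_coverCount_le_one (D := fun j => P.iterDigits (m * k) j i) (hy k)
      (Multiset.count_ne_zero.1 hk) (hsub p hyp) (Multiset.count_ne_zero.1 hk') (hsub p' hyp')
    rw [Prod.mk.injEq] at h
    exact Prod.ext h.1 (sub_left_injective h.2)
  refine ⟨m, hm, X, ⟨hfix', fun j => ⟨isUniformlyDiscrete_of_ae_unique hX1 hae (hint j),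
    isRelativelyDense_of_covers (hA.pow hm) (isPrimitive_iterate hP hm) hT.1 hfix' hcov j⟩,
    T, (hT.iterate m).isUnique (hA.pow hm) (isPrimitive_iterate hP hm), hpos, hcov, ?_⟩, hfix⟩
  filter_upwards [hae] with y hy
  obtain ⟨p, hp, hyp⟩ := hcov y
  exact ⟨p, ⟨hp, hyp⟩, fun p' hp' => hy p' p hp'.1 hp'.2 hp hyp⟩

end InflationSystem

theorem MultisetFamily.IsUniformlyDiscrete.isWeaklyUniformlyDiscrete {d n : ℕ} (hn : 0 < n)
    {X : MultisetFamily d n} (hX : X.IsUniformlyDiscrete) : X.IsWeaklyUniformlyDiscrete := by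
  have : Nonempty (Fin n) := ⟨⟨0, hn⟩⟩
  choose r hr hX using hX
  obtain ⟨i₀, hi₀⟩ := Finite.exists_min r
  refine ⟨r i₀, hr i₀, n, hn, fun c s hs => ?_⟩
  rw [Finset.sum_comm]
  calc ∑ i, ∑ x ∈ s, X i x ≤ ∑ _i : Fin n, 1 :=
        Finset.sum_le_sum fun i _ => hX i c s (hs.trans (Metric.ball_subset_ball (hi₀ i)))
    _ = n := by simp

theorem mainTheorem3 {d n : ℕ} (hd : 0 < d) (hn : 0 < n)
    (A : Matrix (Fin d) (Fin d) ℝ) (hA : A.IsExpanding)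
    (D : Fin n → Fin n → Finset (EuclideanSpace ℝ (Fin d)))
    (P : InflationSystem d n) (hP : P = InflationSystem.ofDigitSets A D)
    (hprim : P.subdivisionMatrix.IsPrimitive)
    (hperron : P.subdivisionMatrix.perronEigenvalue = |A.det|) :
    List.TFAE [
      ∃ N : ℕ, 0 < N ∧ ∃ X : MultisetFamily d n,
        X.IsNonempty ∧ X.IsWeaklyUniformlyDiscrete ∧ P.inflation^[N] X = X,
      ∃ N : ℕ, 0 < N ∧ ∃ X : MultisetFamily d n,
        X.IsNonempty ∧ X.IsUniformlyDiscrete ∧ P.inflation^[N] X = X,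
      ∃ N : ℕ, 0 < N ∧ ∃ X : MultisetFamily d n,
        (P.iterate N).IsSelfReplicatingMultiTilingFamily X ∧ P.inflation^[N] X = X,
      ∃ T : Fin n → Set (EuclideanSpace ℝ (Fin d)),
        P.IsUniqueCompactMultiTileSolution T ∧ ∀ i, 0 < MeasureTheory.volume (T i)] := by
  have hmat : P.mat = A := by rw [hP]; rfl
  rw [← hmat] at hperron hA
  have hcontr := hA.hasContractingInverse hd
  tfae_have 3 → 2 := by
    rintro ⟨N, hN, X, hX, hfix⟩
    obtain ⟨R, -, hR⟩ := (hX.2.1 ⟨0, hn⟩).2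
    obtain ⟨x, -, hx⟩ := hR 0
    exact ⟨N, hN, X, ⟨_, x, hx⟩, fun i => (hX.2.1 i).1, hfix⟩
  tfae_have 2 → 1 := by
    rintro ⟨N, hN, X, hne, hX, hfix⟩
    exact ⟨N, hN, X, hne, hX.isWeaklyUniformlyDiscrete hn, hfix⟩
  tfae_have 1 → 4 := by
    rintro ⟨N, hN, X, hne, hX, hfix⟩
    have hD : ∀ i, ∃ j e, e ∈ P.digits j i := by
      intro i
      obtain ⟨k, hk0, hk⟩ := InflationSystem.exists_forall_iterDigits_nonempty hprim
      obtain ⟨k, rfl⟩ : ∃ l, k = l + 1 := ⟨k - 1, by omega⟩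
      obtain ⟨e, he⟩ := hk i i
      obtain ⟨l, -, -, b, hb, -⟩ := InflationSystem.mem_iterDigits_succ.1 he
      exact ⟨l, b, hb⟩
    obtain ⟨T, hT⟩ := InflationSystem.exists_isCompactMultiTileSolution hn hcontr hD
    exact ⟨T, hT.isUnique hcontr hprim,
      InflationSystem.volume_pos_of_isWeaklyUniformlyDiscrete hn hcontr hprim hperron hN hne hX
        hfix hT⟩
  tfae_have 4 → 3 := by
    rintro ⟨T, hT, hpos⟩
    exact hT.1.exists_isSelfReplicatingMultiTilingFamily hn hcontr hprim hperron hpos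
  tfae_finish
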